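/- **Stochastic error bound.** Let $\mathcal H=L^2([0,1])$ (real-valued functions), with operator norm $\|\cdot\|_{\mathrm{op}}$ and Hilbert–Schmidt norm $\|\cdot\|_{\mathrm{HS}}$, and write $(f\otimes g)(h)=\langle g,h\rangle f$. Let $\Psi$ be a Hilbert–Schmidt operator on $\mathcal H$ and let $(\varepsilon_t)_{t\in\mathbb Z}$, $(X_t)_{t\in\mathbb Z}$ be $\mathcal H$-valued random processes. Assume: 1. (Stationarity and moments) $\|\Psi\|_{\mathrm{op}}<1$; the $\varepsilon_t$ are i.i.d. with $\mathbb E\,\varepsilon_t=0$ and $\mathbb E\|\varepsilon_t\|^4<\infty$; and $(X_t)$ is a strictly stationary solution of $X_t=\Psi X_{t-1}+\varepsilon_t$, $t\in\mathbb Z$ (almost surely for each $t$). Put $C_0=\mathbb E[X_t\otimes X_t]$ and $C_1=\mathbb E[X_{t+1}\otimes X_t]$. 2. (Covariance operator) $C_0$ is injective, compact and of trace class, and its eigenvalues $\lambda_1\ge\lambda_2\ge\dots>0$, repeated according to multiplicity, satisfy $c_1k^{-a}\le\lambda_k\le c_2k^{-a}$ for all $k\ge1$, for some constants $0<c_1\le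 c_2<\infty$ and $a>1$. 3. (Source condition) There are constants $\beta>0$, $0\le\rho<\infty$ and a Hilbert–Schmidt operator $F$ with $\|F\|_{\mathrm{HS}}\le\rho$ such that $\Psi=F\,C_0^{\,\beta}$. 4. (Weak dependence) $(X_t)$ is $L^4$-$m$-approximable: $\mathbb E\|X_t\|^4<\infty$ and $X_t=f(\eta_t,\eta_{t-1},\dots)$ almost surely, for i.i.d. random elements $(\eta_t)_{t\in\mathbb Z}$ of a measurable space $S$ and a measurable $f:S^{\mathbb N}\to\mathcal H$, and with an independent copy $(\eta'_t)$ of $(\eta_t)$ and $X_t^{(m)}=f(\eta_t,\dots,\eta_{t-m+1},\eta'_{t-m},\eta'_{t-m-1},\dots)$ one has $\sum_{m\ge1}\bigl(\mathbb E\|X_t-X_t^{(m)}\|^4\bigr)^{1/4}<\infty$. For a sample $X_1,\dots,X_n$ let $\bar X=\frac1n\sum_{t=1}^nX_t$, $$\widehat C_0=\frac1n\sum_{t=1}^n(X_t-\bar X)\otimes(X_t-\bar X),\qquad \widehat C_1=\frac1{n-1}\sum_{t=1}^{n-1}(X_{t+1}-\bar X)\otimes(X_t-\bar X),$$ and for $\alpha>0$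 let $\widehat\Psi_\alpha=\widehat C_1(\widehat C_0+\alpha I)^{-1}$ and $\Psi_\alpha=C_1(C_0+\alpha I)^{-1}$. Then for every sequence $\alpha_n>0$ with $\alpha_n\ge n^{-1/2}$ for all $n\ge1$, $$\bigl\|\widehat\Psi_{\alpha_n}-\Psi_{\alpha_n}\bigr\|_{\mathrm{HS}}=O_P\Bigl(\frac1{\sqrt n\,\alpha_n}\Bigr)\qquad(n\to\infty),$$ that is, for every $\delta>0$ there is $M>0$ such that $\mathbb P\bigl(\|\widehat\Psi_{\alpha_n}-\Psi_{\alpha_n}\|_{\mathrm{HS}}>M/(\sqrt n\,\alpha_n)\bigr)\le\delta$ for all sufficiently large $n$. -/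

import Mathlib

open MeasureTheory ProbabilityTheory InnerProductSpace Filter
open scoped ENNReal NNReal Topology

noncomputable section

/-! ### Hilbert–Schmidt and trace class operators -/

section Operators

/-- The index set of a fixed Hilbert basis of `H`. -/
def basisIndex (H : Type*) [NormedAddCommGroup H] [InnerProductSpace ℝ H] [CompleteSpace H] :
    Set H :=
  (exists_hilbertBasis ℝ H).choose

/-- A fixed Hilbert basis of `H`. -/
def stdHilbertBasis (H : Type*) [NormedAddCommGroup H] [InnerProductSpace ℝ H]
    [CompleteSpace H] : HilbertBasis (basisIndex H) ℝ H :=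
  (exists_hilbertBasis ℝ H).choose_spec.choose

/-- The Hilbert–Schmidt norm `(∑ᵢ ‖T eᵢ‖²)^(1/2)`, with value `∞` if `T` is not a
Hilbert–Schmidt operator. It does not depend on the Hilbert basis: see
`hsNorm_eq_of_hilbertBasis`. -/
def hsNorm {H : Type*} [NormedAddCommGroup H] [InnerProductSpace ℝ H] [CompleteSpace H]
    (T : H →L[ℝ] H) : ℝ≥0∞ :=
  (∑' i, ‖T (stdHilbertBasis H i)‖ₑ ^ 2) ^ (1 / 2 : ℝ)

/-- `T` is a Hilbert–Schmidt operator. -/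
def IsHilbertSchmidt {H : Type*} [NormedAddCommGroup H] [InnerProductSpace ℝ H]
    [CompleteSpace H] (T : H →L[ℝ] H) : Prop :=
  hsNorm T < ∞

lemma enorm_sq_eq_tsum_hilbertBasis {H : Type*} [NormedAddCommGroup H] [InnerProductSpace ℝ H]
    {ι : Type*} (b : HilbertBasis ι ℝ H) (x : H) :
    ‖x‖ₑ ^ 2 = ∑' i, ‖inner ℝ (b i) x‖ₑ ^ 2 := by
  have h := b.hasSum_inner_mul_inner x x
  have h2 : HasSum (fun i => ‖inner ℝ (b i) x‖ ^ 2) (‖x‖ ^ 2) := by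
    rw [← real_inner_self_eq_norm_sq]
    have e : (fun i => ‖inner ℝ (b i) x‖ ^ 2) = fun i => inner ℝ x (b i) * inner ℝ (b i) x := by
      funext i
      rw [real_inner_comm, Real.norm_eq_abs, sq_abs, sq]
    rw [e]
    exact h
  have h3 := ENNReal.ofReal_tsum_of_nonneg (fun i => by positivity) h2.summable
  rw [h2.tsum_eq] at h3
  rw [← ofReal_norm, ← ENNReal.ofReal_pow (norm_nonneg _), h3]
  refine tsum_congr fun i => ?_
  rw [ENNReal.ofReal_pow (norm_nonneg _), ofReal_norm]

lemma tsum_enorm_sq_adjoint {H : Type*} [NormedAddCommGroup H] [InnerProductSpace ℝ H]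
    [CompleteSpace H] {ι κ : Type*} (b : HilbertBasis ι ℝ H) (c : HilbertBasis κ ℝ H)
    (T : H →L[ℝ] H) :
    ∑' i, ‖T (b i)‖ₑ ^ 2 = ∑' k, ‖ContinuousLinearMap.adjoint T (c k)‖ₑ ^ 2 := by
  simp_rw [enorm_sq_eq_tsum_hilbertBasis c (T _),
    enorm_sq_eq_tsum_hilbertBasis b (ContinuousLinearMap.adjoint T _)]
  rw [ENNReal.tsum_comm]
  refine tsum_congr fun k => tsum_congr fun i => ?_
  rw [ContinuousLinearMap.adjoint_inner_right, real_inner_comm]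

/-- The Hilbert–Schmidt norm may be computed in any Hilbert basis. -/
lemma hsNorm_eq_of_hilbertBasis {H : Type*} [NormedAddCommGroup H] [InnerProductSpace ℝ H]
    [CompleteSpace H] {ι : Type*} (b : HilbertBasis ι ℝ H) (T : H →L[ℝ] H) :
    hsNorm T = (∑' i, ‖T (b i)‖ₑ ^ 2) ^ (1 / 2 : ℝ) := by
  rw [hsNorm, tsum_enorm_sq_adjoint _ b, tsum_enorm_sq_adjoint b b,
    ContinuousLinearMap.adjoint_adjoint]

/-- `T` is a trace class (nuclear) operator: an absolutely convergent sum of rank one operators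
`h ↦ ⟪y k, h⟫ • x k`. -/
def IsTraceClass {H : Type*} [NormedAddCommGroup H] [InnerProductSpace ℝ H] (T : H →L[ℝ] H) :
    Prop :=
  ∃ x y : ℕ → H, Summable (fun k => ‖x k‖ * ‖y k‖) ∧
    HasSum (fun k => rankOne ℝ (x k) (y k)) T

/-- The eigenspace of `T` for `μ`. -/
def eigSpace {H : Type*} [NormedAddCommGroup H] [InnerProductSpace ℝ H] (T : H →L[ℝ] H) (μ : ℝ) :
    Submodule ℝ H :=
  (T - μ • ContinuousLinearMap.id ℝ H).ker

instance eigSpace_complete {H : Type*} [NormedAddCommGroup H] [InnerProductSpace ℝ H] [CompleteSpace H]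
    (T : H →L[ℝ] H) (μ : ℝ) : CompleteSpace (eigSpace T μ) :=
  ContinuousLinearMap.completeSpace_ker (T - μ • ContinuousLinearMap.id ℝ H)

/-- `l 0 ≥ l 1 ≥ …` is the list of all eigenvalues of `T`, each one repeated according to its
multiplicity. -/
def IsEigenvalueSeq {H : Type*} [NormedAddCommGroup H] [InnerProductSpace ℝ H]
    (T : H →L[ℝ] H) (l : ℕ → ℝ) : Prop :=
  Antitone l ∧
    ∀ μ : ℝ, Cardinal.toENat (Module.rank ℝ (eigSpace T μ)) = {k : ℕ | l k = μ}.encard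

/-- The fractional power `T ^ β`, `β > 0`, of a compact positive self-adjoint operator `T`, by
its spectral decomposition `T ^ β = ∑_μ μ ^ β P_μ`, where `P_μ` is the orthogonal projection
onto the eigenspace of `T` for `μ` (which is zero unless `μ` is an eigenvalue). -/
def opRpow {H : Type*} [NormedAddCommGroup H] [InnerProductSpace ℝ H] [CompleteSpace H]
    (T : H →L[ℝ] H) (β : ℝ) (x : H) : H :=
  ∑' μ : ℝ, μ ^ β • (eigSpace T μ).starProjection x

/-- The resolvent `(T + α I)⁻¹`. -/
def resolventInv {H : Type*} [NormedAddCommGroup H] [InnerProductSpace ℝ H]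
    (T : H →L[ℝ] H) (α : ℝ) : H →L[ℝ] H :=
  Ring.inverse (T + α • ContinuousLinearMap.id ℝ H)

/-- For a positive operator `T` and `α > 0` the operator `T + α I` is boundedly invertible, so
that `resolventInv T α` is its inverse. -/
lemma isUnit_add_smul_id {H : Type*} [NormedAddCommGroup H] [InnerProductSpace ℝ H]
    [CompleteSpace H] {T : H →L[ℝ] H} (hT : T.IsPositive) {α : ℝ} (hα : 0 < α) :
    IsUnit (T + α • ContinuousLinearMap.id ℝ H) := by
  refine ContinuousLinearMap.isUnit_of_forall_le_norm_inner_map _ (c := ⟨α, hα.le⟩) hα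
    fun x => ?_
  have h := hT.inner_nonneg_left x
  have e : inner ℝ ((T + α • ContinuousLinearMap.id ℝ H) x) x
      = inner ℝ (T x) x + α * ‖x‖ ^ 2 := by
    simp [inner_add_left, inner_smul_left]
  rw [e, Real.norm_eq_abs]
  refine le_trans ?_ (le_abs_self _)
  change ‖x‖ ^ 2 * α ≤ _
  linarith

end Operators

/-! ### Probabilistic notions -/

section Probability

/-- `Y n = O_P(r n)` for random variables `Y n` with values in `[0, ∞]`. -/
def IsBigOP {Ω : Type*} [MeasurableSpace Ω] (P : Measure Ω) (Y : ℕ → Ω → ℝ≥0∞) (r : ℕ → ℝ) :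
    Prop :=
  ∀ δ : ℝ, 0 < δ → ∃ M : ℝ, 0 < M ∧
    ∀ᶠ n in atTop, P {ω | ENNReal.ofReal (M * r n) < Y n ω} ≤ ENNReal.ofReal δ

/-- Strict stationarity: the law of the whole process is invariant under time shifts. -/
def IsStrictlyStationary {Ω H : Type*} [MeasurableSpace Ω] [MeasurableSpace H]
    (P : Measure Ω) (X : ℤ → Ω → H) : Prop :=
  ∀ s : ℤ, IdentDistrib (fun ω (t : ℤ) => X (t + s) ω) (fun ω (t : ℤ) => X t ω) P P

/-- `X` is a stationary solution of `X_t = Ψ X_{t-1} + ε_t`, `t ∈ ℤ`, with `Ψ` a Hilbert–Schmidt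
operator of operator norm less than one and i.i.d. innovations with mean zero and finite fourth
moment. -/
structure IsStationaryFAR {Ω H : Type*} [MeasurableSpace Ω] [NormedAddCommGroup H]
    [InnerProductSpace ℝ H] [CompleteSpace H] [MeasurableSpace H] (P : Measure Ω)
    (Ψ : H →L[ℝ] H) (ε X : ℤ → Ω → H) : Prop where
  hilbertSchmidt : IsHilbertSchmidt Ψ
  norm_lt_one : ‖Ψ‖ < 1
  measurable_innov : ∀ t, Measurable (ε t)
  indep : iIndepFun ε P
  identDistrib : ∀ t, IdentDistrib (ε t) (ε 0) P P
  memLp : ∀ t, MemLp (ε t) 4 P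
  mean_zero : ∀ t, ∫ ω, ε t ω ∂P = 0
  measurable_process : ∀ t, Measurable (X t)
  stationary : IsStrictlyStationary P X
  far : ∀ t, ∀ᵐ ω ∂P, X t ω = Ψ (X (t - 1) ω) + ε t ω

/-- `L⁴`-`m`-approximability (Hörmann and Kokoszka): `X_t = f(η_t, η_{t-1}, …)` for i.i.d.
elements `η_t` of a measurable space and a measurable `f`, and the approximations
`X_t^{(m)} = f(η_t, …, η_{t-m+1}, η'_{t-m}, η'_{t-m-1}, …)`, where `η'` is an independent copy of
`η`, satisfy `∑_{m ≥ 1} (E‖X_t - X_t^{(m)}‖⁴)^{1/4} < ∞`. The independent copy lives on the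
second factor of the product probability space `Ω × Ω`. -/
def IsL4mApproximable {Ω H : Type*} [MeasurableSpace Ω] [NormedAddCommGroup H]
    [MeasurableSpace H] (P : Measure Ω) (X : ℤ → Ω → H) : Prop :=
  (∀ t, MemLp (X t) 4 P) ∧
  ∃ (S : Type) (_ : MeasurableSpace S) (η : ℤ → Ω → S) (f : (ℕ → S) → H),
    (∀ t, Measurable (η t)) ∧ iIndepFun η P ∧ (∀ t, IdentDistrib (η t) (η 0) P P) ∧
    Measurable f ∧
    (∀ t : ℤ, ∀ᵐ ω ∂P, X t ω = f (fun j : ℕ => η (t - j) ω)) ∧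
    ∀ t : ℤ, ∑' m : ℕ, eLpNorm
      (fun p : Ω × Ω => X t p.1 -
        f (fun j : ℕ => if j < m + 1 then η (t - j) p.1 else η (t - j) p.2)) 4 (P.prod P) < ∞

end Probability

/-! ### Covariance operators and the Tikhonov estimator -/

section Estimator

/-- The covariance operator `C₀ = E[X_t ⊗ X_t]` of a stationary process of mean zero
(the same for all `t`), with `(f ⊗ g)(h) = ⟪g, h⟫ f`. -/
def covOp {Ω H : Type*} [MeasurableSpace Ω] [NormedAddCommGroup H] [InnerProductSpace ℝ H]
    (P : Measure Ω) (X : ℤ → Ω → H) : H →L[ℝ] H :=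
  ∫ ω, rankOne ℝ (X 0 ω) (X 0 ω) ∂P

/-- The lag-one cross-covariance operator `C₁ = E[X_{t+1} ⊗ X_t]`. -/
def crossCovOp {Ω H : Type*} [MeasurableSpace Ω] [NormedAddCommGroup H] [InnerProductSpace ℝ H]
    (P : Measure Ω) (X : ℤ → Ω → H) : H →L[ℝ] H :=
  ∫ ω, rankOne ℝ (X 1 ω) (X 0 ω) ∂P

/-- The sample mean of `X_1, …, X_n`. -/
def sampleMean {Ω H : Type*} [NormedAddCommGroup H] [InnerProductSpace ℝ H]
    (X : ℤ → Ω → H) (n : ℕ) (ω : Ω) : H :=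
  (n : ℝ)⁻¹ • ∑ t ∈ Finset.Icc 1 n, X (t : ℤ) ω

/-- The sample covariance operator. -/
def sampleCovOp {Ω H : Type*} [NormedAddCommGroup H] [InnerProductSpace ℝ H]
    (X : ℤ → Ω → H) (n : ℕ) (ω : Ω) : H →L[ℝ] H :=
  (n : ℝ)⁻¹ • ∑ t ∈ Finset.Icc 1 n,
    rankOne ℝ (X (t : ℤ) ω - sampleMean X n ω) (X (t : ℤ) ω - sampleMean X n ω)

/-- The sample lag-one cross-covariance operator. -/
def sampleCrossCovOp {Ω H : Type*} [NormedAddCommGroup H] [InnerProductSpace ℝ H]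
    (X : ℤ → Ω → H) (n : ℕ) (ω : Ω) : H →L[ℝ] H :=
  ((n : ℝ) - 1)⁻¹ • ∑ t ∈ Finset.Icc 1 (n - 1),
    rankOne ℝ (X ((t : ℤ) + 1) ω - sampleMean X n ω) (X (t : ℤ) ω - sampleMean X n ω)

/-- The population Tikhonov operator `Ψ_α = C₁ (C₀ + α I)⁻¹`. -/
def tikhonovOp {Ω H : Type*} [MeasurableSpace Ω] [NormedAddCommGroup H] [InnerProductSpace ℝ H]
    (P : Measure Ω) (X : ℤ → Ω → H) (α : ℝ) : H →L[ℝ] H :=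
  crossCovOp P X ∘L resolventInv (covOp P X) α

/-- The Tikhonov estimator `Ĉ₁ (Ĉ₀ + α I)⁻¹` from the sample `X_1, …, X_n`. -/
def tikhonovEstimator {Ω H : Type*} [NormedAddCommGroup H] [InnerProductSpace ℝ H]
    (X : ℤ → Ω → H) (n : ℕ) (α : ℝ) (ω : Ω) : H →L[ℝ] H :=
  sampleCrossCovOp X n ω ∘L resolventInv (sampleCovOp X n ω) α

/-- The assumption on the covariance operator: it is injective, compact and of trace class, and
its eigenvalues `l 0 ≥ l 1 ≥ … > 0` decay polynomially. The index is shifted: `l k` is the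
`(k + 1)`-st eigenvalue. -/
def CovarianceAssumption {H : Type*} [NormedAddCommGroup H] [InnerProductSpace ℝ H]
    (C₀ : H →L[ℝ] H) : Prop :=
  Function.Injective C₀ ∧ IsCompactOperator C₀ ∧ IsTraceClass C₀ ∧
    ∃ l : ℕ → ℝ, IsEigenvalueSeq C₀ l ∧ (∀ k, 0 < l k) ∧
      ∃ c₁ c₂ a : ℝ, 0 < c₁ ∧ c₁ ≤ c₂ ∧ 1 < a ∧
        ∀ k : ℕ, c₁ * ((k : ℝ) + 1) ^ (-a) ≤ l k ∧ l k ≤ c₂ * ((k : ℝ) + 1) ^ (-a)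

/-- The source condition `Ψ = F C₀ ^ β` with `β > 0` and `‖F‖_HS ≤ ρ < ∞`. -/
def SourceCondition {H : Type*} [NormedAddCommGroup H] [InnerProductSpace ℝ H] [CompleteSpace H]
    (Ψ C₀ : H →L[ℝ] H) : Prop :=
  ∃ β : ℝ, 0 < β ∧ ∃ ρ : ℝ≥0, ∃ F : H →L[ℝ] H, hsNorm F ≤ (ρ : ℝ≥0∞) ∧
    ∀ x, Ψ x = F (opRpow C₀ β x)

end Estimator

/-! ### The state space -/

/-- The real Hilbert space `L²([0,1])`. -/
abbrev L2I : Type := Lp ℝ 2 (volume.restrict (Set.Icc (0 : ℝ) 1))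

/-- `L²([0,1])` carries its Borel σ-algebra. -/
instance L2I.measurableSpace : MeasurableSpace L2I := borel L2I

instance L2I.borelSpace : BorelSpace L2I := ⟨rfl⟩

end

/-!
The estimation error of the Tikhonov estimator is split by the resolvent identity,
`Ĉ₁ R' - C₁ R = (Ĉ₁ - C₁) R' - C₁ R (Ĉ₀ - C₀) R'` with `R = (C₀ + α)⁻¹` and `R' = (Ĉ₀ + α)⁻¹`.
Since the innovation `ε (t + 1)` is independent of `X t`, the Yule–Walker equation `C₁ = Ψ C₀`
holds, so that `C₁ R = Ψ (C₀ R)` is a contraction, and the error is at most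
`α⁻¹ (‖Ĉ₁ - C₁‖ + ‖Ĉ₀ - C₀‖)` in Hilbert–Schmidt norm (`hsNorm_comp_resolventInv_sub_le`). By
Markov's inequality it remains to see that both sample covariance operators are `√n`-consistent
in mean.

For this the autoregressive equation is used directly. A stationary solution is causal
(`IsStationaryFAR.aestronglyMeasurable_pastSigma`), and `Z t = X t ⊗ X t - C₀` satisfies
`Z t = Ψ Z (t - 1) Ψ* + N t` with a noise `N t` that has conditional mean zero given the past and a
bounded second Hilbert–Schmidt moment. Summing over the sample, and because `T ↦ Ψ T Ψ*` contracts
the Hilbert–Schmidt norm, `∑ Z t` is bounded by a constant times `∑ N t` and two boundary terms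
(`hsNorm_sum_le_of_recursion`). The operators `N t` are orthogonal in mean, whence `∑ N t` is of
order `√n` by Pythagoras (`lintegral_hsNorm_sum_le`). The same argument in `H` bounds the sample
mean, and `∑ X (t + 1) ⊗ X t` is `Ψ ∑ X t ⊗ X t` plus the sum of the orthogonal operators
`ε (t + 1) ⊗ X t`.

The Hilbert–Schmidt norm is handled through its values on a fixed Hilbert basis, which is countable
as `H` is separable; thus integrals of its square are sums of integrals of squared norms in `H`.
-/

/-! ### The Hilbert–Schmidt norm -/

section HilbertSchmidt

variable {H : Type*} [NormedAddCommGroup H] [InnerProductSpace ℝ H] [CompleteSpace H]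

lemma hsNorm_sq (T : H →L[ℝ] H) : hsNorm T ^ 2 = ∑' i, ‖T (stdHilbertBasis H i)‖ₑ ^ 2 := by
  rw [hsNorm, ← ENNReal.rpow_natCast, ← ENNReal.rpow_mul]
  norm_num

lemma hsNorm_le_of_sq_le {T : H →L[ℝ] H} {c : ℝ≥0∞} (h : hsNorm T ^ 2 ≤ c ^ 2) : hsNorm T ≤ c :=
  (ENNReal.pow_le_pow_left_iff two_ne_zero).1 h

lemma hsNorm_add_le (S T : H →L[ℝ] H) : hsNorm (S + T) ≤ hsNorm S + hsNorm T := by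
  -- Minkowski's inequality for the counting measure on the index set of the basis
  let _ : MeasurableSpace (basisIndex H) := ⊤
  have h := ENNReal.lintegral_Lp_add_le (μ := Measure.count) (p := 2)
    (f := fun i : basisIndex H => ‖S (stdHilbertBasis H i)‖ₑ)
    (g := fun i : basisIndex H => ‖T (stdHilbertBasis H i)‖ₑ)
    measurable_from_top.aemeasurable measurable_from_top.aemeasurable (by norm_num)
  simp only [lintegral_count, Pi.add_apply, ENNReal.rpow_ofNat] at h
  refine le_trans ?_ h
  rw [hsNorm]
  refine ENNReal.rpow_le_rpow (ENNReal.tsum_le_tsum fun i => ?_) (by norm_num)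
  gcongr
  exact enorm_add_le _ _

@[simp] lemma hsNorm_zero : hsNorm (0 : H →L[ℝ] H) = 0 := by
  simp [hsNorm]

@[simp] lemma hsNorm_neg (T : H →L[ℝ] H) : hsNorm (-T) = hsNorm T := by
  simp [hsNorm]

lemma hsNorm_sub_le (S T : H →L[ℝ] H) : hsNorm (S - T) ≤ hsNorm S + hsNorm T := by
  rw [sub_eq_add_neg, ← hsNorm_neg T]
  exact hsNorm_add_le _ _

lemma hsNorm_sum_le {κ : Type*} (s : Finset κ) (T : κ → H →L[ℝ] H) :
    hsNorm (∑ k ∈ s, T k) ≤ ∑ k ∈ s, hsNorm (T k) :=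
  Finset.le_sum_of_subadditive _ hsNorm_zero.le hsNorm_add_le _ _

lemma hsNorm_comp_le (S T : H →L[ℝ] H) : hsNorm (S ∘L T) ≤ ‖S‖ₑ * hsNorm T := by
  refine hsNorm_le_of_sq_le ?_
  rw [mul_pow, hsNorm_sq, hsNorm_sq, ← ENNReal.tsum_mul_left]
  refine ENNReal.tsum_le_tsum fun i => ?_
  rw [← mul_pow]
  gcongr
  exact S.le_opENorm _

lemma hsNorm_adjoint (T : H →L[ℝ] H) : hsNorm (ContinuousLinearMap.adjoint T) = hsNorm T := by
  rw [hsNorm, hsNorm, tsum_enorm_sq_adjoint (stdHilbertBasis H) (stdHilbertBasis H) T]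

lemma hsNorm_comp_le' (S T : H →L[ℝ] H) : hsNorm (S ∘L T) ≤ hsNorm S * ‖T‖ₑ := by
  rw [← hsNorm_adjoint, ContinuousLinearMap.adjoint_comp, mul_comm, ← hsNorm_adjoint S]
  refine (hsNorm_comp_le _ _).trans_eq ?_
  rw [← ofReal_norm, ← ofReal_norm, LinearIsometryEquiv.norm_map]

lemma hsNorm_smul (c : ℝ) (T : H →L[ℝ] H) : hsNorm (c • T) = ‖c‖ₑ * hsNorm T := by
  refine (ENNReal.pow_right_strictMono two_ne_zero).injective ?_
  rw [mul_pow, hsNorm_sq, hsNorm_sq, ← ENNReal.tsum_mul_left]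
  simp [enorm_smul, mul_pow]

lemma hsNorm_rankOne (x y : H) : hsNorm (rankOne ℝ x y) = ‖x‖ₑ * ‖y‖ₑ := by
  refine (ENNReal.pow_right_strictMono two_ne_zero).injective ?_
  rw [hsNorm_sq, mul_pow, enorm_sq_eq_tsum_hilbertBasis (stdHilbertBasis H) y,
    ← ENNReal.tsum_mul_left]
  refine tsum_congr fun i => ?_
  rw [rankOne_apply, enorm_smul, mul_pow, mul_comm, real_inner_comm]

lemma countable_basisIndex [SecondCountableTopology H] : Countable (basisIndex H) := by
  let b := stdHilbertBasis H
  -- the open balls of radius `1 / 2` around the basis vectors are disjoint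
  have hd : (Set.univ : Set (basisIndex H)).PairwiseDisjoint
      fun i => Metric.ball (b i) (1 / 2) := by
    intro i _ j _ hij
    refine Metric.ball_disjoint_ball ?_
    have h1 : ‖b i - b j‖ ^ 2 = 2 := by
      rw [@norm_sub_sq_real, b.orthonormal.1 i, b.orthonormal.1 j, b.orthonormal.2 hij]
      norm_num
    rw [dist_eq_norm]
    nlinarith [norm_nonneg (b i - b j)]
  exact Set.countable_univ_iff.1 (hd.countable_of_isOpen (fun _ _ => Metric.isOpen_ball)
    fun i _ => ⟨b i, Metric.mem_ball_self (by norm_num)⟩)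

end HilbertSchmidt

/-! ### Resolvents of positive operators -/

section Resolvent

variable {H : Type*} [NormedAddCommGroup H] [InnerProductSpace ℝ H]

/-- Both bounds follow from `‖(T + α) x‖² = ‖T x‖² + 2 α ⟪T x, x⟫ + α² ‖x‖²`. -/
lemma resolvent_apply_bounds {T : H →L[ℝ] H} (hT : T.IsPositive) {α : ℝ} (hα : 0 < α) (x : H) :
    α * ‖x‖ ≤ ‖(T + α • ContinuousLinearMap.id ℝ H) x‖ ∧
      ‖T x‖ ≤ ‖(T + α • ContinuousLinearMap.id ℝ H) x‖ := by
  have h : ‖(T + α • ContinuousLinearMap.id ℝ H) x‖ ^ 2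
      = ‖T x‖ ^ 2 + 2 * (α * inner ℝ (T x) x) + (α * ‖x‖) ^ 2 := by
    have e : (T + α • ContinuousLinearMap.id ℝ H) x = T x + α • x := rfl
    rw [e, @norm_add_sq_real, inner_smul_right, norm_smul, Real.norm_of_nonneg hα.le]
  have h0 : 0 ≤ α * inner ℝ (T x) x := mul_nonneg hα.le (hT.inner_nonneg_left x)
  constructor <;> refine le_of_sq_le_sq ?_ (norm_nonneg _) <;> rw [h] <;>
    nlinarith [sq_nonneg ‖T x‖, sq_nonneg (α * ‖x‖)]

variable [CompleteSpace H]

lemma add_smul_id_comp_resolventInv {T : H →L[ℝ] H} (hT : T.IsPositive) {α : ℝ} (hα : 0 < α) :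
    (T + α • ContinuousLinearMap.id ℝ H) ∘L resolventInv T α = ContinuousLinearMap.id ℝ H :=
  Ring.mul_inverse_cancel _ (isUnit_add_smul_id hT hα)

lemma resolventInv_comp_add_smul_id {T : H →L[ℝ] H} (hT : T.IsPositive) {α : ℝ} (hα : 0 < α) :
    resolventInv T α ∘L (T + α • ContinuousLinearMap.id ℝ H) = ContinuousLinearMap.id ℝ H :=
  Ring.inverse_mul_cancel _ (isUnit_add_smul_id hT hα)

lemma norm_resolventInv_le {T : H →L[ℝ] H} (hT : T.IsPositive) {α : ℝ} (hα : 0 < α) :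
    ‖resolventInv T α‖ ≤ α⁻¹ := by
  refine ContinuousLinearMap.opNorm_le_bound _ (by positivity) fun x => ?_
  have h := (resolvent_apply_bounds hT hα (resolventInv T α x)).1
  rw [← ContinuousLinearMap.comp_apply, add_smul_id_comp_resolventInv hT hα,
    ContinuousLinearMap.id_apply] at h
  rwa [inv_mul_eq_div, le_div_iff₀' hα]

lemma norm_comp_resolventInv_le {T : H →L[ℝ] H} (hT : T.IsPositive) {α : ℝ} (hα : 0 < α) :
    ‖T ∘L resolventInv T α‖ ≤ 1 := by
  refine ContinuousLinearMap.opNorm_le_bound _ zero_le_one fun x => ?_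
  have h := (resolvent_apply_bounds hT hα (resolventInv T α x)).2
  rw [← ContinuousLinearMap.comp_apply (T + _), ← ContinuousLinearMap.comp_apply T,
    add_smul_id_comp_resolventInv hT hα, ContinuousLinearMap.id_apply] at h
  rwa [one_mul]

/-- Perturbation bound for `B ↦ B (A + α I)⁻¹`, at a pair `(A, Ψ A)`: the factor `A (A + α I)⁻¹`
of the first order term is a contraction, so that only one resolvent has to be paid for. -/
lemma hsNorm_comp_resolventInv_sub_le {A A' B' Ψ : H →L[ℝ] H} (hA : A.IsPositive)
    (hA' : A'.IsPositive) (hΨ : ‖Ψ‖ ≤ 1) {α : ℝ} (hα : 0 < α) :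
    hsNorm (B' ∘L resolventInv A' α - (Ψ ∘L A) ∘L resolventInv A α)
      ≤ ENNReal.ofReal α⁻¹ * (hsNorm (B' - Ψ ∘L A) + hsNorm (A' - A)) := by
  set R := resolventInv A α with hR
  set R' := resolventInv A' α with hR'
  have e1 : R - R' = R ∘L (A' - A) ∘L R' := by
    have h1 : A' - A = (A' + α • ContinuousLinearMap.id ℝ H)
        - (A + α • ContinuousLinearMap.id ℝ H) := by abel
    rw [h1, ContinuousLinearMap.sub_comp, ContinuousLinearMap.comp_sub,
      add_smul_id_comp_resolventInv hA' hα, ← ContinuousLinearMap.comp_assoc R,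
      resolventInv_comp_add_smul_id hA hα]
    rfl
  have e : B' ∘L R' - (Ψ ∘L A) ∘L R
      = (B' - Ψ ∘L A) ∘L R' - (Ψ ∘L (A ∘L R)) ∘L (A' - A) ∘L R' := by
    have h2 : (Ψ ∘L (A ∘L R)) ∘L (A' - A) ∘L R' = (Ψ ∘L A) ∘L (R - R') := by rw [e1]; rfl
    rw [h2, ContinuousLinearMap.sub_comp, ContinuousLinearMap.comp_sub]
    abel
  have hn : ‖R'‖ₑ ≤ ENNReal.ofReal α⁻¹ := by
    rw [← ofReal_norm]
    exact ENNReal.ofReal_le_ofReal (norm_resolventInv_le hA' hα)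
  have hc : ‖Ψ ∘L (A ∘L R)‖ₑ ≤ 1 := by
    rw [← ofReal_norm, ← ENNReal.ofReal_one]
    refine ENNReal.ofReal_le_ofReal ((ContinuousLinearMap.opNorm_comp_le _ _).trans ?_)
    exact mul_le_one₀ hΨ (norm_nonneg _) (norm_comp_resolventInv_le hA hα)
  rw [e, mul_add]
  refine (hsNorm_sub_le _ _).trans (add_le_add ?_ ?_)
  · rw [mul_comm]
    exact (hsNorm_comp_le' _ _).trans (by gcongr)
  · refine (hsNorm_comp_le _ _).trans ?_
    calc _ ≤ 1 * (hsNorm (A' - A) * ‖R'‖ₑ) := by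
          gcongr
          exact hsNorm_comp_le' _ _
      _ ≤ _ := by
          rw [one_mul, mul_comm]
          gcongr

end Resolvent

/-! ### Elementary estimates in `[0, ∞]` -/

section ENNReal

lemma ENNReal.mul_le_sq_add_sq (a b : ℝ≥0∞) : a * b ≤ a ^ 2 + b ^ 2 := by
  rcases le_total a b with h | h
  · calc a * b ≤ b ^ 2 := by rw [sq]; gcongr
      _ ≤ _ := le_add_self
  · calc a * b ≤ a ^ 2 := by rw [sq]; gcongr
      _ ≤ _ := le_self_add

lemma ENNReal.add_sq_le (a b : ℝ≥0∞) : (a + b) ^ 2 ≤ 4 * (a ^ 2 + b ^ 2) := by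
  have h (c d : ℝ≥0∞) (hcd : c ≤ d) : (c + d) ^ 2 ≤ 4 * (c ^ 2 + d ^ 2) :=
    calc (c + d) ^ 2 ≤ (d + d) ^ 2 := by gcongr
      _ = 4 * d ^ 2 := by ring
      _ ≤ 4 * (c ^ 2 + d ^ 2) := by gcongr; exact le_add_self
  rcases le_total a b with hab | hab
  · exact h a b hab
  · rw [add_comm a, add_comm (a ^ 2)]
    exact h b a hab

lemma ENNReal.le_inv_mul_of_le_add_mul {a b c : ℝ≥0∞} (ha : a ≠ ∞) (hc : c < 1)
    (h : a ≤ b + c * a) : a ≤ (1 - c)⁻¹ * b := by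
  have h1 : (1 - c) * a ≤ b := by
    rw [ENNReal.sub_mul fun _ _ => ha, one_mul]
    exact tsub_le_iff_right.2 h
  have h0 : 1 - c ≠ 0 := (tsub_pos_of_lt hc).ne'
  have ht : 1 - c ≠ ∞ := ENNReal.sub_ne_top ENNReal.one_ne_top
  calc a = (1 - c)⁻¹ * ((1 - c) * a) := by
        rw [← mul_assoc, ENNReal.inv_mul_cancel h0 ht, one_mul]
    _ ≤ _ := by gcongr

end ENNReal

/-! ### Square integrability, independence and orthogonality -/

section Integration

/-- If `U` is measurable with respect to `m`, `e` is independent of `m` and `φ (u, e)` has mean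
zero for each fixed `u`, then `φ (U, e)` has mean zero. -/
lemma integral_eq_zero_of_indep {Ω E F G : Type*} {m mΩ : MeasurableSpace Ω} {P : Measure Ω}
    [TopologicalSpace E] [TopologicalSpace.PseudoMetrizableSpace E] [SecondCountableTopology E]
    [MeasurableSpace E] [BorelSpace E] [TopologicalSpace F] [TopologicalSpace.PseudoMetrizableSpace F]
    [SecondCountableTopology F] [MeasurableSpace F] [BorelSpace F]
    [NormedAddCommGroup G] [NormedSpace ℝ G] [IsProbabilityMeasure P]
    (hm : m ≤ mΩ) {U : Ω → E} {e : Ω → F}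
    (hU : AEStronglyMeasurable[m] U P) (he : Measurable e)
    (hind : Indep m (MeasurableSpace.comap e inferInstance) P)
    {φ : E × F → G} (hφ : Continuous φ) (hint : Integrable (fun ω => φ (U ω, e ω)) P)
    (h0 : ∀ u, ∫ ω, φ (u, e ω) ∂P = 0) : ∫ ω, φ (U ω, e ω) ∂P = 0 := by
  obtain ⟨V, hV, hUV⟩ := hU
  have hVm : Measurable V := hV.measurable.mono hm le_rfl
  have hae : (fun ω => φ (U ω, e ω)) =ᵐ[P] fun ω => φ (V ω, e ω) := by
    filter_upwards [hUV] with ω hω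
    rw [hω]
  rw [integral_congr_ae hae]
  have hVe : IndepFun V e P := indep_of_indep_of_le_left hind hV.measurable.comap_le
  have hmap := hVe.map_prod_eq_prod_map_map hVm.aemeasurable he.aemeasurable
  have hφm (ν : Measure (E × F)) : AEStronglyMeasurable φ ν :=
    hφ.stronglyMeasurable.aestronglyMeasurable
  have : IsProbabilityMeasure (P.map V) := Measure.isProbabilityMeasure_map hVm.aemeasurable
  have : IsProbabilityMeasure (P.map e) := Measure.isProbabilityMeasure_map he.aemeasurable
  have hint' : Integrable φ ((P.map V).prod (P.map e)) := by
    rw [← hmap, integrable_map_measure (hφm _) (hVm.prodMk he).aemeasurable]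
    exact (integrable_congr hae).1 hint
  have h1 := integral_map (μ := P) (hVm.prodMk he).aemeasurable (hφm _)
  rw [← h1, hmap, integral_prod _ hint']
  refine integral_eq_zero_of_ae (Eventually.of_forall fun u => ?_)
  have h2 := integral_map (μ := P) (f := fun y => φ (u, y)) he.aemeasurable
    ((hφ.comp (Continuous.prodMk_right u)).stronglyMeasurable).aestronglyMeasurable
  exact h2.trans (h0 u)

variable {Ω : Type*} {mΩ : MeasurableSpace Ω} {P : Measure Ω}

/-- Jensen's inequality for the square. -/
lemma lintegral_sq_le [IsProbabilityMeasure P] {Y : Ω → ℝ≥0∞} (hY : AEMeasurable Y P) :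
    (∫⁻ ω, Y ω ∂P) ^ 2 ≤ ∫⁻ ω, Y ω ^ 2 ∂P := by
  have h := ENNReal.lintegral_mul_le_Lp_mul_Lq P Real.HolderConjugate.two_two hY
    (aemeasurable_const (b := 1))
  simp only [Pi.mul_apply, mul_one, ENNReal.rpow_ofNat, one_pow, lintegral_one, measure_univ,
    ENNReal.one_rpow] at h
  calc _ ≤ ((∫⁻ ω, Y ω ^ 2 ∂P) ^ (1 / 2 : ℝ)) ^ 2 := by gcongr
    _ = _ := by
      rw [← ENNReal.rpow_natCast, ← ENNReal.rpow_mul]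
      norm_num

variable {H : Type*} [NormedAddCommGroup H] [InnerProductSpace ℝ H]

/-- The product of two functions in `L⁴` is in `L²`. -/
instance ENNReal.HolderTriple.four_four_two : ENNReal.HolderTriple 4 4 2 where
  inv_add_inv_eq_inv := by
    have h : (4 : ℝ≥0∞)⁻¹ = 2⁻¹ * 2⁻¹ := by
      rw [← ENNReal.mul_inv (by norm_num) (by norm_num)]
      norm_num
    rw [h, ← mul_add, ENNReal.inv_two_add_inv_two, mul_one]

lemma MeasureTheory.MemLp.integrable_inner {f g : Ω → H} (hf : MemLp f 2 P) (hg : MemLp g 2 P) :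
    Integrable (fun ω => inner ℝ (f ω) (g ω)) P := by
  rw [← memLp_one_iff_integrable]
  refine hf.of_bilin (r := 1) (fun x y => inner ℝ x y) 1 hg (hf.1.inner hg.1)
    (Eventually.of_forall fun ω => ?_)
  simpa using nnnorm_inner_le_nnnorm (𝕜 := ℝ) (f ω) (g ω)

lemma MeasureTheory.MemLp.inner_smul {p r : ℝ≥0∞} [ENNReal.HolderTriple p p r] {f g : Ω → H}
    (hf : MemLp f p P) (hg : MemLp g p P) (v : H) :
    MemLp (fun ω => inner ℝ (f ω) v • g ω) r P :=
  hg.smul (hf.inner_const v)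

lemma lintegral_enorm_sq_eq {f : Ω → H} (hf : MemLp f 2 P) :
    ∫⁻ ω, ‖f ω‖ₑ ^ 2 ∂P = ENNReal.ofReal (∫ ω, inner ℝ (f ω) (f ω) ∂P) := by
  rw [ofReal_integral_eq_lintegral_ofReal (hf.integrable_inner hf)
    (Eventually.of_forall fun ω => real_inner_self_nonneg)]
  refine lintegral_congr fun ω => ?_
  rw [real_inner_self_eq_norm_sq, ENNReal.ofReal_pow (norm_nonneg _), ofReal_norm]

/-- Pythagoras for random vectors that are orthogonal in mean. -/
lemma lintegral_enorm_sum_sq {ι : Type*} (s : Finset ι) {D : ι → Ω → H}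
    (hD : ∀ i, MemLp (D i) 2 P) (hort : ∀ i j, i ≠ j → ∫ ω, inner ℝ (D i ω) (D j ω) ∂P = 0) :
    ∫⁻ ω, ‖∑ i ∈ s, D i ω‖ₑ ^ 2 ∂P = ∑ i ∈ s, ∫⁻ ω, ‖D i ω‖ₑ ^ 2 ∂P := by
  have hs : MemLp (fun ω => ∑ i ∈ s, D i ω) 2 P := memLp_finsetSum s fun i _ => hD i
  have hi i j := (hD i).integrable_inner (hD j)
  rw [lintegral_enorm_sq_eq hs]
  simp_rw [lintegral_enorm_sq_eq (hD _), sum_inner, inner_sum]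
  rw [integral_finsetSum _ fun i _ => integrable_finsetSum _ fun j _ => hi i j,
    ← ENNReal.ofReal_sum_of_nonneg fun i _ => integral_nonneg fun ω => real_inner_self_nonneg]
  congr 1
  refine Finset.sum_congr rfl fun i his => ?_
  rw [integral_finsetSum _ fun j _ => hi i j]
  exact Finset.sum_eq_single i (fun j _ hj => hort i j hj.symm) fun h => absurd his h

lemma continuous_rankOne : Continuous fun p : H × H => rankOne ℝ p.1 p.2 :=
  ((rankOne ℝ).continuous.comp continuous_fst).clm_apply continuous_snd

lemma MeasureTheory.AEStronglyMeasurable.rankOne {f g : Ω → H} (hf : AEStronglyMeasurable f P)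
    (hg : AEStronglyMeasurable g P) :
    AEStronglyMeasurable (fun ω => rankOne ℝ (f ω) (g ω)) P := by
  have h := continuous_rankOne.comp_aestronglyMeasurable (hf.prodMk hg)
  exact h

lemma integrable_rankOne {f g : Ω → H} (hf : MemLp f 2 P) (hg : MemLp g 2 P) :
    Integrable (fun ω => rankOne ℝ (f ω) (g ω)) P := by
  refine Integrable.mono' (g := fun ω => ‖f ω‖ * ‖g ω‖) ?_ (hf.1.rankOne hg.1) ?_
  · exact hf.norm.integrable_mul hg.norm
  · refine Eventually.of_forall fun ω => ?_
    exact (norm_rankOne _ _).le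

variable [CompleteSpace H] [SecondCountableTopology H]

lemma lintegral_hsNorm_sq {N : Ω → H →L[ℝ] H}
    (hN : ∀ v, AEStronglyMeasurable (fun ω => N ω v) P) :
    ∫⁻ ω, hsNorm (N ω) ^ 2 ∂P = ∑' k, ∫⁻ ω, ‖N ω (stdHilbertBasis H k)‖ₑ ^ 2 ∂P := by
  have := countable_basisIndex (H := H)
  simp_rw [hsNorm_sq]
  exact lintegral_tsum fun k => ((hN _).enorm.pow_const 2)

lemma aemeasurable_hsNorm {N : Ω → H →L[ℝ] H}
    (hN : ∀ v, AEStronglyMeasurable (fun ω => N ω v) P) :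
    AEMeasurable (fun ω => hsNorm (N ω)) P := by
  have := countable_basisIndex (H := H)
  exact (AEMeasurable.tsum fun k => ((hN _).enorm.pow_const 2)).pow_const _

/-- Pythagoras for random operators whose values at each vector are orthogonal in mean. -/
lemma lintegral_hsNorm_sum_sq {ι : Type*} (s : Finset ι) {N : ι → Ω → H →L[ℝ] H}
    (hN : ∀ i v, MemLp (fun ω => N i ω v) 2 P)
    (hort : ∀ i j v, i ≠ j → ∫ ω, inner ℝ (N i ω v) (N j ω v) ∂P = 0) :
    ∫⁻ ω, hsNorm (∑ i ∈ s, N i ω) ^ 2 ∂P = ∑ i ∈ s, ∫⁻ ω, hsNorm (N i ω) ^ 2 ∂P := by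
  rw [lintegral_hsNorm_sq fun v => by
    simpa using (memLp_finsetSum s fun i _ => hN i v).1]
  simp_rw [lintegral_hsNorm_sq fun v => (hN _ v).1]
  rw [← Summable.tsum_finsetSum fun _ _ => ENNReal.summable]
  refine tsum_congr fun k => ?_
  simp_rw [_root_.sum_apply]
  exact lintegral_enorm_sum_sq s (fun i => hN i _) fun i j hij => hort i j _ hij

/-- Jensen's inequality for the squared Hilbert–Schmidt norm of a random operator. -/
lemma hsNorm_integral_sq_le [IsProbabilityMeasure P] {N : Ω → H →L[ℝ] H} (hN : Integrable N P) :
    hsNorm (∫ ω, N ω ∂P) ^ 2 ≤ ∫⁻ ω, hsNorm (N ω) ^ 2 ∂P := by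
  rw [lintegral_hsNorm_sq fun v => (hN.apply_continuousLinearMap v).1, hsNorm_sq]
  refine ENNReal.tsum_le_tsum fun k => ?_
  rw [ContinuousLinearMap.integral_apply hN]
  calc _ ≤ (∫⁻ ω, ‖N ω (stdHilbertBasis H k)‖ₑ ∂P) ^ 2 := by
        gcongr
        exact enorm_integral_le_lintegral_enorm _
    _ ≤ _ := lintegral_sq_le (hN.apply_continuousLinearMap _).1.enorm

end Integration

/-! ### The past of the innovations -/

section Past

variable {Ω H : Type*} [MeasurableSpace H]

/-- The σ-algebra generated by the innovations up to time `t`. -/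
@[reducible] def pastSigma (ε : ℤ → Ω → H) (t : ℤ) : MeasurableSpace Ω :=
  ⨆ j ∈ Set.Iic t, MeasurableSpace.comap (ε j) inferInstance

lemma pastSigma_le [mΩ : MeasurableSpace Ω] {ε : ℤ → Ω → H} (hε : ∀ t, Measurable (ε t))
    (t : ℤ) : pastSigma ε t ≤ mΩ :=
  iSup₂_le fun j _ => (hε j).comap_le

lemma pastSigma_mono (ε : ℤ → Ω → H) : Monotone (pastSigma ε) := fun _ _ hst =>
  biSup_mono fun _ hj => Set.Iic_subset_Iic.2 hst hj

lemma measurable_pastSigma (ε : ℤ → Ω → H) {j t : ℤ} (hj : j ≤ t) :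
    Measurable[pastSigma ε t] (ε j) :=
  measurable_iff_comap_le.2
    (le_iSup₂_of_le (f := fun j (_ : j ∈ Set.Iic t) => MeasurableSpace.comap (ε j) inferInstance)
      j hj le_rfl)

lemma indep_pastSigma [MeasurableSpace Ω] {P : Measure Ω} {ε : ℤ → Ω → H}
    (hε : ∀ t, Measurable (ε t))
    (hind : iIndepFun ε P) {s t : ℤ} (hst : s < t) :
    Indep (pastSigma ε s) (MeasurableSpace.comap (ε t) inferInstance) P := by
  have h := indep_iSup_of_disjoint (fun j => (hε j).comap_le) hind
    (S := Set.Iic s) (T := {t}) (by simpa using hst)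
  simp only [Set.mem_singleton_iff, iSup_iSup_eq_left] at h
  exact h

end Past

/-- For a sub-σ-algebra `m`, an almost everywhere limit of `m`-measurable functions agrees almost
everywhere with an `m`-measurable function, although the set of convergence to `g` need not belong
to `m`. -/
lemma aestronglyMeasurable_of_tendsto_ae_of_stronglyMeasurable {Ω E : Type*}
    {m mΩ : MeasurableSpace Ω} {P : Measure Ω} [TopologicalSpace E]
    [TopologicalSpace.IsCompletelyMetrizableSpace E] {f : ℕ → Ω → E} {g : Ω → E}
    (hf : ∀ i, StronglyMeasurable[m] (f i))
    (h : ∀ᵐ ω ∂P, Tendsto (fun i => f i ω) atTop (𝓝 (g ω))) : AEStronglyMeasurable[m] g P := by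
  rcases isEmpty_or_nonempty Ω with hΩ | ⟨⟨ω₀⟩⟩
  · exact .of_subsingleton_dom
  have : Nonempty E := ⟨g ω₀⟩
  refine ⟨fun ω => limUnder atTop fun i => f i ω,
    @StronglyMeasurable.limUnder _ _ _ m _ _ _ _ _ _ _ hf, ?_⟩
  filter_upwards [h] with ω hω
  exact hω.limUnder_eq.symm

/-! ### Consequences of the autoregressive equation -/

namespace IsStationaryFAR

variable {Ω H : Type*} [MeasurableSpace Ω] [NormedAddCommGroup H] [InnerProductSpace ℝ H]
  [CompleteSpace H] [MeasurableSpace H] {P : Measure Ω} {Ψ : H →L[ℝ] H} {ε X : ℤ → Ω → H}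

lemma identDistrib_process (h : IsStationaryFAR P Ψ ε X) (t : ℤ) :
    IdentDistrib (X t) (X 0) P P := by
  simpa [Function.comp_def] using (h.stationary t).comp (measurable_pi_apply (0 : ℤ))

lemma memLp_process [BorelSpace H] (h : IsStationaryFAR P Ψ ε X) (hX : MemLp (X 0) 4 P) (t : ℤ) :
    MemLp (X t) 4 P :=
  (h.identDistrib_process t).memLp_iff.2 hX

lemma memLp_two_process [BorelSpace H] [IsProbabilityMeasure P] (h : IsStationaryFAR P Ψ ε X)
    (hX : MemLp (X 0) 4 P) (t : ℤ) : MemLp (X t) 2 P :=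
  (h.memLp_process hX t).mono_exponent (by norm_num)

lemma memLp_two_innov [IsProbabilityMeasure P] (h : IsStationaryFAR P Ψ ε X) (t : ℤ) :
    MemLp (ε t) 2 P :=
  (h.memLp t).mono_exponent (by norm_num)

lemma enorm_lt_one (h : IsStationaryFAR P Ψ ε X) : ‖Ψ‖ₑ < 1 := by
  rw [← ofReal_norm, ← ENNReal.ofReal_one]
  exact (ENNReal.ofReal_lt_ofReal_iff one_pos).2 h.norm_lt_one

lemma iterate_eq (h : IsStationaryFAR P Ψ ε X) (t : ℤ) (J : ℕ) :
    ∀ᵐ ω ∂P, X t ω = (Ψ ^ J) (X (t - J) ω) + ∑ j ∈ Finset.range J, (Ψ ^ j) (ε (t - j) ω) := by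
  induction J with
  | zero => simp
  | succ J ih =>
    filter_upwards [ih, h.far (t - J)] with ω h1 h2
    rw [h1, h2, Finset.sum_range_succ, map_add, pow_succ, Nat.cast_add, Nat.cast_one,
      ← sub_sub]
    simp only [mul_apply_eq_comp]
    abel

lemma integral_inner_innov [IsProbabilityMeasure P] (h : IsStationaryFAR P Ψ ε X) (t : ℤ) (v : H) :
    ∫ ω, inner ℝ (ε t ω) v ∂P = 0 := by
  simp_rw [real_inner_comm v]
  rw [integral_inner ((h.memLp_two_innov t).integrable (by norm_num)), h.mean_zero,
    inner_zero_right]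

variable [BorelSpace H]

/-- By stationarity `C₀` may be computed at any time `t`. -/
lemma covOp_apply [IsProbabilityMeasure P] (h : IsStationaryFAR P Ψ ε X) (hX : MemLp (X 0) 4 P)
    (t : ℤ) (v : H) : covOp P X v = ∫ ω, inner ℝ (X t ω) v • X t ω ∂P := by
  have hX2 := h.memLp_two_process hX 0
  have hc : Continuous fun x : H => inner ℝ x v • x := by fun_prop
  rw [covOp, ContinuousLinearMap.integral_apply (integrable_rankOne hX2 hX2)]
  exact ((h.identDistrib_process t).comp hc.measurable).integral_eq.symm

lemma isPositive_covOp [IsProbabilityMeasure P] (h : IsStationaryFAR P Ψ ε X)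
    (hX : MemLp (X 0) 4 P) : (covOp P X).IsPositive := by
  have hX2 := h.memLp_two_process hX 0
  have hi (u v : H) : inner ℝ (covOp P X u) v
      = ∫ ω, inner ℝ (X 0 ω) u * inner ℝ (X 0 ω) v ∂P := by
    rw [h.covOp_apply hX 0, real_inner_comm,
      ← integral_inner ((hX2.inner_smul hX2 u).integrable le_rfl)]
    simp_rw [inner_smul_right, real_inner_comm v]
  refine ⟨fun u v => ?_, fun u => ?_⟩
  · have := hi v u
    simp only [ContinuousLinearMap.coe_coe]
    rw [hi, real_inner_comm, hi]
    simp_rw [mul_comm]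
  · change 0 ≤ inner ℝ (covOp P X u) u
    rw [hi]
    exact integral_nonneg fun ω => mul_self_nonneg _

variable [SecondCountableTopology H]

/-- A stationary solution is causal: `X t` is the limit of the sums `∑_{j < J} Ψ ^ j ε (t - j)`,
hence a function of the innovations up to time `t`. -/
lemma aestronglyMeasurable_pastSigma [IsProbabilityMeasure P] (h : IsStationaryFAR P Ψ ε X)
    (hX : MemLp (X 0) 4 P) (t : ℤ) : AEStronglyMeasurable[pastSigma ε t] (X t) P := by
  set Y : ℕ → Ω → H := fun J ω => ∑ j ∈ Finset.range J, (Ψ ^ j) (ε (t - j) ω) with hY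
  have hYm (J : ℕ) : StronglyMeasurable[pastSigma ε t] (Y J) := by
    refine Finset.stronglyMeasurable_fun_sum _ fun j _ => ?_
    exact (Ψ ^ j).continuous.comp_stronglyMeasurable
      (measurable_pastSigma ε (by lia)).stronglyMeasurable
  have hle := pastSigma_le h.measurable_innov t
  have hlim : Tendsto (fun J => eLpNorm (Y J - X t) 4 P) atTop (𝓝 0) := by
    have hb (J : ℕ) : eLpNorm (Y J - X t) 4 P ≤ ‖Ψ‖ₑ ^ J * eLpNorm (X 0) 4 P := by
      rw [← (h.identDistrib_process (t - J)).eLpNorm_eq]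
      have h1 : eLpNorm (Y J - X t) 4 P = eLpNorm (fun ω => (Ψ ^ J) (X (t - J) ω)) 4 P := by
        refine eLpNorm_congr_norm_ae ?_
        filter_upwards [h.iterate_eq t J] with ω hω
        rw [Pi.sub_apply, hω, sub_add_cancel_right, norm_neg]
      rw [h1]
      refine eLpNorm_le_mul_eLpNorm_of_ae_le_mul'' 4
        (h.measurable_process _).aestronglyMeasurable (Eventually.of_forall fun ω => ?_)
      clear h1
      generalize X (t - J) ω = x
      induction J with
      | zero => simp
      | succ J ih =>
        rw [pow_succ', mul_apply_eq_comp, pow_succ', mul_assoc]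
        exact (Ψ.le_opENorm _).trans (by gcongr)
    refine tendsto_of_tendsto_of_tendsto_of_le_of_le tendsto_const_nhds ?_ (fun _ => zero_le) hb
    have := ENNReal.Tendsto.mul_const (b := eLpNorm (X 0) 4 P)
      (ENNReal.tendsto_pow_atTop_nhds_zero_of_lt_one h.enorm_lt_one) (Or.inr hX.2.ne)
    rwa [zero_mul] at this
  obtain ⟨ns, -, hns⟩ := (tendstoInMeasure_of_tendsto_eLpNorm (by norm_num)
    (fun J => ((hYm J).mono hle).aestronglyMeasurable)
    (h.measurable_process t).aestronglyMeasurable hlim).exists_seq_tendsto_ae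
  exact aestronglyMeasurable_of_tendsto_ae_of_stronglyMeasurable (fun i => hYm (ns i)) hns

/-- Functions of the past and of a later innovation have mean zero as soon as they do for each
fixed past. -/
lemma integral_innov_eq_zero [IsProbabilityMeasure P] (h : IsStationaryFAR P Ψ ε X)
    {E G : Type*} [TopologicalSpace E]
    [TopologicalSpace.PseudoMetrizableSpace E] [SecondCountableTopology E] [MeasurableSpace E]
    [BorelSpace E] [NormedAddCommGroup G] [NormedSpace ℝ G] {s t : ℤ} (hst : s < t)
    {U : Ω → E} (hU : AEStronglyMeasurable[pastSigma ε s] U P) {φ : E × H → G} (hφ : Continuous φ)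
    (hint : Integrable (fun ω => φ (U ω, ε t ω)) P) (h0 : ∀ u, ∫ ω, φ (u, ε t ω) ∂P = 0) :
    ∫ ω, φ (U ω, ε t ω) ∂P = 0 :=
  integral_eq_zero_of_indep (pastSigma_le h.measurable_innov s) hU (h.measurable_innov t)
    (indep_pastSigma h.measurable_innov h.indep hst) hφ hint h0

lemma integral_inner_process_smul_innov [IsProbabilityMeasure P] (h : IsStationaryFAR P Ψ ε X)
    (hX : MemLp (X 0) 4 P) {s t : ℤ} (hst : s < t) (v : H) :
    ∫ ω, inner ℝ (X s ω) v • ε t ω ∂P = 0 := by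
  refine h.integral_innov_eq_zero hst (h.aestronglyMeasurable_pastSigma hX s)
    (φ := fun p : H × H => inner ℝ p.1 v • p.2) (by fun_prop)
    (((h.memLp_two_process hX s).inner_smul (h.memLp_two_innov t) v).integrable le_rfl) fun u => ?_
  change ∫ ω, inner ℝ u v • ε t ω ∂P = 0
  rw [integral_smul, h.mean_zero, smul_zero]

lemma integral_inner_innov_smul_process [IsProbabilityMeasure P] (h : IsStationaryFAR P Ψ ε X)
    (hX : MemLp (X 0) 4 P) {s t : ℤ} (hst : s < t) (v : H) :
    ∫ ω, inner ℝ (ε t ω) v • X s ω ∂P = 0 := by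
  refine h.integral_innov_eq_zero hst (h.aestronglyMeasurable_pastSigma hX s)
    (φ := fun p : H × H => inner ℝ p.2 v • p.1) (by fun_prop)
    (((h.memLp_two_innov t).inner_smul (h.memLp_two_process hX s) v).integrable le_rfl) fun u => ?_
  change ∫ ω, inner ℝ (ε t ω) v • u ∂P = 0
  rw [integral_smul_const, h.integral_inner_innov, zero_smul]

/-! ### The covariance operators -/

/-- The Yule–Walker equation `C₁ = Ψ C₀`. -/
lemma crossCovOp_eq [IsProbabilityMeasure P] (h : IsStationaryFAR P Ψ ε X)
    (hX : MemLp (X 0) 4 P) : crossCovOp P X = Ψ ∘L covOp P X := by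
  have hX2 := h.memLp_two_process hX
  ext1 v
  have hi := ((hX2 0).inner_smul (hX2 0) v (r := 1)).integrable le_rfl
  rw [crossCovOp, ContinuousLinearMap.integral_apply (integrable_rankOne (hX2 1) (hX2 0)),
    ContinuousLinearMap.comp_apply, h.covOp_apply hX 0, ← Ψ.integral_comp_comm hi]
  have he : (fun ω => rankOne ℝ (X 1 ω) (X 0 ω) v)
      =ᵐ[P] fun ω => Ψ (inner ℝ (X 0 ω) v • X 0 ω) + inner ℝ (X 0 ω) v • ε 1 ω := by
    filter_upwards [h.far 1] with ω hω
    rw [rankOne_apply, hω, map_smul, ← smul_add, sub_self]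
  rw [integral_congr_ae he, integral_add (Ψ.integrable_comp hi)
    (((hX2 0).inner_smul (h.memLp_two_innov 1) v).integrable le_rfl),
    h.integral_inner_process_smul_innov hX one_pos, add_zero]

/-- The covariance operator of the innovations is `C₀ - Ψ C₀ Ψ*`. -/
lemma covOp_sub_apply [IsProbabilityMeasure P] (h : IsStationaryFAR P Ψ ε X)
    (hX : MemLp (X 0) 4 P) (t : ℤ) (v : H) :
    (covOp P X - Ψ ∘L covOp P X ∘L ContinuousLinearMap.adjoint Ψ) v
      = ∫ ω, inner ℝ (ε t ω) v • ε t ω ∂P := by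
  have hX2 := h.memLp_two_process hX
  have hε2 := h.memLp_two_innov t
  set w := ContinuousLinearMap.adjoint Ψ v with hw
  have hi1 := ((hX2 (t - 1)).inner_smul (hX2 (t - 1)) w (r := 1)).integrable le_rfl
  have hi2 := ((hX2 (t - 1)).inner_smul hε2 w (r := 1)).integrable le_rfl
  have hi3 := (hε2.inner_smul (hX2 (t - 1)) v (r := 1)).integrable le_rfl
  have hi4 := (hε2.inner_smul hε2 v (r := 1)).integrable le_rfl
  have he : (fun ω => inner ℝ (X t ω) v • X t ω)
      =ᵐ[P] fun ω => Ψ (inner ℝ (X (t - 1) ω) w • X (t - 1) ω) + inner ℝ (X (t - 1) ω) w • ε t ω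
        + Ψ (inner ℝ (ε t ω) v • X (t - 1) ω) + inner ℝ (ε t ω) v • ε t ω := by
    filter_upwards [h.far t] with ω hω
    rw [hw, ContinuousLinearMap.adjoint_inner_right, map_smul, map_smul, hω, inner_add_left]
    module
  have h1 : covOp P X v = Ψ (covOp P X w) + 0 + Ψ 0 + ∫ ω, inner ℝ (ε t ω) v • ε t ω ∂P := by
    have hj1 := Ψ.integrable_comp hi1
    have hj3 := Ψ.integrable_comp hi3
    rw [h.covOp_apply hX t v, integral_congr_ae he,
      integral_add (by exact (hj1.add hi2).add hj3) hi4,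
      integral_add (by exact hj1.add hi2) hj3, integral_add hj1 hi2, Ψ.integral_comp_comm hi1,
      Ψ.integral_comp_comm hi3, h.integral_inner_process_smul_innov hX (sub_one_lt t),
      h.integral_inner_innov_smul_process hX (sub_one_lt t), ← h.covOp_apply hX (t - 1)]
  simp only [sub_apply, ContinuousLinearMap.comp_apply]
  rw [h1, hw]
  simp

end IsStationaryFAR

/-! ### Linear recursions over a window -/

section Recursion

lemma sum_Icc_sub_one {A : Type*} [AddCommGroup A] (f : ℤ → A) (n : ℕ) :
    ∑ t ∈ Finset.Icc 1 n, f ((t : ℤ) - 1) = ∑ t ∈ Finset.Icc 1 n, f t + f 0 - f n := by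
  induction n with
  | zero => simp
  | succ n ih =>
    rw [Finset.sum_Icc_succ_top (by lia), Finset.sum_Icc_succ_top (by lia), ih]
    push_cast
    rw [add_sub_cancel_right]
    abel

/-- Summation of `f t = L (f (t - 1)) + g t`: the shifted sum differs from the original one only by
its boundary terms. -/
lemma sum_Icc_eq_of_recursion {A : Type*} [AddCommGroup A] {f g : ℤ → A} (L : A →+ A)
    (h : ∀ t, f t = L (f (t - 1)) + g t) (n : ℕ) :
    ∑ t ∈ Finset.Icc 1 n, f t
      = L (∑ t ∈ Finset.Icc 1 n, f t) + (L (f 0) - L (f n)) + ∑ t ∈ Finset.Icc 1 n, g t := by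
  have h1 : ∑ t ∈ Finset.Icc 1 n, f t
      = L (∑ t ∈ Finset.Icc 1 n, f ((t : ℤ) - 1)) + ∑ t ∈ Finset.Icc 1 n, g t := by
    rw [map_sum, ← Finset.sum_add_distrib]
    exact Finset.sum_congr rfl fun t _ => h t
  rw [sum_Icc_sub_one, map_sub, map_add] at h1
  refine h1.trans ?_
  abel

end Recursion

section Algebra

variable {H : Type*} [NormedAddCommGroup H] [InnerProductSpace ℝ H]

lemma sum_rankOne_sub {ι : Type*} (s : Finset ι) (f g : ι → H) (x : H) :
    ∑ t ∈ s, rankOne ℝ (f t - x) (g t - x)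
      = ∑ t ∈ s, rankOne ℝ (f t) (g t) - rankOne ℝ (∑ t ∈ s, f t) x
        - rankOne ℝ x (∑ t ∈ s, g t) + (s.card : ℝ) • rankOne ℝ x x := by
  simp only [map_sub, sub_apply, Finset.sum_sub_distrib, map_sum, sum_apply, Finset.sum_const,
    Nat.cast_smul_eq_nsmul]
  abel

/-- Stability of the recursion `x t = Ψ (x (t - 1)) + e t`. -/
lemma enorm_sum_le_of_recursion {Ψ : H →L[ℝ] H} (hΨ : ‖Ψ‖ₑ < 1) {x e : ℤ → H}
    (h : ∀ t, x t = Ψ (x (t - 1)) + e t) (n : ℕ) :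
    ‖∑ t ∈ Finset.Icc 1 n, x t‖ₑ ≤ (1 - ‖Ψ‖ₑ)⁻¹ *
      (‖x 0‖ₑ + ‖x n‖ₑ + ‖∑ t ∈ Finset.Icc 1 n, e t‖ₑ) := by
  refine ENNReal.le_inv_mul_of_le_add_mul (by finiteness) hΨ ?_
  have hL1 (y : H) : ‖Ψ y‖ₑ ≤ ‖y‖ₑ :=
    (Ψ.le_opENorm y).trans (mul_le_of_le_one_left zero_le hΨ.le)
  calc ‖∑ t ∈ Finset.Icc 1 n, x t‖ₑ
      = ‖Ψ (∑ t ∈ Finset.Icc 1 n, x t) + (Ψ (x 0) - Ψ (x n)) + ∑ t ∈ Finset.Icc 1 n, e t‖ₑ :=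
        congrArg _ (sum_Icc_eq_of_recursion (Ψ : H →ₗ[ℝ] H).toAddMonoidHom h n)
    _ ≤ ‖Ψ‖ₑ * ‖∑ t ∈ Finset.Icc 1 n, x t‖ₑ + (‖x 0‖ₑ + ‖x n‖ₑ)
        + ‖∑ t ∈ Finset.Icc 1 n, e t‖ₑ := by
      refine (enorm_add_le _ _).trans (add_le_add ((enorm_add_le _ _).trans
        (add_le_add (Ψ.le_opENorm _) (enorm_sub_le.trans (add_le_add (hL1 _) (hL1 _))))) le_rfl)
    _ = _ := by ring

variable [CompleteSpace H]

lemma enorm_adjoint (Ψ : H →L[ℝ] H) : ‖ContinuousLinearMap.adjoint Ψ‖ₑ = ‖Ψ‖ₑ := by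
  rw [← ofReal_norm, ← ofReal_norm, LinearIsometryEquiv.norm_map]

lemma hsNorm_comp_comp_le (Ψ T A : H →L[ℝ] H) :
    hsNorm (Ψ ∘L T ∘L A) ≤ ‖Ψ‖ₑ * ‖A‖ₑ * hsNorm T := by
  refine (hsNorm_comp_le _ _).trans ?_
  rw [mul_assoc, mul_comm ‖A‖ₑ]
  gcongr
  exact hsNorm_comp_le' _ _

/-- Stability of the recursion `T t = Ψ T (t - 1) A + N t`. -/
lemma hsNorm_sum_le_of_recursion {Ψ A : H →L[ℝ] H} (hΨ : ‖Ψ‖ₑ * ‖A‖ₑ < 1)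
    {T N : ℤ → H →L[ℝ] H} (hT : ∀ t, hsNorm (T t) ≠ ∞)
    (h : ∀ t, T t = Ψ ∘L T (t - 1) ∘L A + N t) (n : ℕ) :
    hsNorm (∑ t ∈ Finset.Icc 1 n, T t) ≤ (1 - ‖Ψ‖ₑ * ‖A‖ₑ)⁻¹ *
      (hsNorm (T 0) + hsNorm (T n) + hsNorm (∑ t ∈ Finset.Icc 1 n, N t)) := by
  refine ENNReal.le_inv_mul_of_le_add_mul ?_ hΨ ?_
  · have h1 := hsNorm_sum_le (Finset.Icc 1 n) fun t : ℕ => T t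
    have h2 : ∑ t ∈ Finset.Icc 1 n, hsNorm (T (t : ℕ)) < ∞ :=
      ENNReal.sum_lt_top.2 fun t _ => (hT t).lt_top
    exact (h1.trans_lt h2).ne
  · let L : (H →L[ℝ] H) →+ (H →L[ℝ] H) :=
      AddMonoidHom.mk' (fun S => Ψ ∘L S ∘L A) fun S S' => by
        rw [ContinuousLinearMap.add_comp, ContinuousLinearMap.comp_add]
    have hL (S : H →L[ℝ] H) : hsNorm (L S) ≤ ‖Ψ‖ₑ * ‖A‖ₑ * hsNorm S :=
      hsNorm_comp_comp_le Ψ S A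
    have hL1 (S : H →L[ℝ] H) : hsNorm (L S) ≤ hsNorm S :=
      (hL S).trans (mul_le_of_le_one_left zero_le hΨ.le)
    calc hsNorm (∑ t ∈ Finset.Icc 1 n, T t)
        = hsNorm (L (∑ t ∈ Finset.Icc 1 n, T t) + (L (T 0) - L (T n))
          + ∑ t ∈ Finset.Icc 1 n, N t) := by rw [← sum_Icc_eq_of_recursion L h]
      _ ≤ ‖Ψ‖ₑ * ‖A‖ₑ * hsNorm (∑ t ∈ Finset.Icc 1 n, T t) + (hsNorm (T 0) + hsNorm (T n))
          + hsNorm (∑ t ∈ Finset.Icc 1 n, N t) := by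
        refine (hsNorm_add_le _ _).trans (add_le_add ((hsNorm_add_le _ _).trans
          (add_le_add (hL _) ((hsNorm_sub_le _ _).trans (add_le_add (hL1 _) (hL1 _))))) le_rfl)
      _ = _ := by ring

end Algebra

/-! ### The sample covariance operators as sums over the sample -/

section Sample

variable {Ω H : Type*} [NormedAddCommGroup H] [InnerProductSpace ℝ H]

lemma isPositive_sampleCovOp (X : ℤ → Ω → H) (n : ℕ) (ω : Ω) :
    (sampleCovOp X n ω).IsPositive := by
  refine ContinuousLinearMap.IsPositive.smul_of_nonneg ?_ (by positivity)
  exact ContinuousLinearMap.isPositive_sum _ fun t _ => isPositive_rankOne_self _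

lemma sum_eq_smul_sampleMean (X : ℤ → Ω → H) {n : ℕ} (hn : n ≠ 0) (ω : Ω) :
    ∑ t ∈ Finset.Icc 1 n, X t ω = (n : ℝ) • sampleMean X n ω := by
  rw [sampleMean, smul_smul, mul_inv_cancel₀ (by exact_mod_cast hn), one_smul]

variable [MeasurableSpace Ω]

/-- The deviation `X t ⊗ X t - C₀`. -/
noncomputable def covDev (P : Measure Ω) (X : ℤ → Ω → H) (t : ℤ) (ω : Ω) : H →L[ℝ] H :=
  rankOne ℝ (X t ω) (X t ω) - covOp P X

lemma sampleCovOp_sub (P : Measure Ω) (X : ℤ → Ω → H) {n : ℕ} (hn : n ≠ 0) (ω : Ω) :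
    sampleCovOp X n ω - covOp P X
      = (n : ℝ)⁻¹ • (∑ t ∈ Finset.Icc 1 n, covDev P X t ω
        - (n : ℝ) • rankOne ℝ (sampleMean X n ω) (sampleMean X n ω)) := by
  have hn' : (n : ℝ) ≠ 0 := by exact_mod_cast hn
  have h1 : covOp P X = (n : ℝ)⁻¹ • (n : ℝ) • covOp P X := by
    rw [smul_smul, inv_mul_cancel₀ hn', one_smul]
  simp only [sampleCovOp, covDev, Finset.sum_sub_distrib, Finset.sum_const, Nat.card_Icc,
    add_tsub_cancel_right]
  conv_lhs => rw [h1]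
  rw [← smul_sub, sum_rankOne_sub, sum_eq_smul_sampleMean X hn]
  simp only [map_smul, smul_apply, Nat.card_Icc, add_tsub_cancel_right,
    ← Nat.cast_smul_eq_nsmul ℝ]
  congr 1
  abel

/-- In the lag-one sample covariance only the end points of the window and the sample mean
add to `Ψ ∑ (X t ⊗ X t - C₀)` and `∑ ε (t + 1) ⊗ X t`. The sample size is `m + 1`, so that the
number of terms `m` is also the normalization. -/
lemma sampleCrossCovOp_sub (P : Measure Ω) {Ψ : H →L[ℝ] H} {ε X : ℤ → Ω → H} {ω : Ω}
    (hω : ∀ t, X t ω = Ψ (X (t - 1) ω) + ε t ω) {m : ℕ} (hm : m ≠ 0) :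
    sampleCrossCovOp X (m + 1) ω - Ψ ∘L covOp P X
      = (m : ℝ)⁻¹ • (Ψ ∘L (∑ t ∈ Finset.Icc 1 (m + 1), covDev P X t ω - covDev P X (m + 1 : ℕ) ω)
        + ∑ t ∈ Finset.Icc 1 m, rankOne ℝ (ε (t + 1) ω) (X t ω)
        + rankOne ℝ (sampleMean X (m + 1) ω) (X (m + 1 : ℕ) ω)
        + rankOne ℝ (X 1 ω) (sampleMean X (m + 1) ω)
        - ((m : ℝ) + 2) • rankOne ℝ (sampleMean X (m + 1) ω) (sampleMean X (m + 1) ω)) := by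
  have hm' : (m : ℝ) ≠ 0 := by exact_mod_cast hm
  have h1 : Ψ ∘L covOp P X = (m : ℝ)⁻¹ • (m : ℝ) • (Ψ ∘L covOp P X) := by
    rw [smul_smul, inv_mul_cancel₀ hm', one_smul]
  set x := sampleMean X (m + 1) ω with hx
  have hsum : ∑ t ∈ Finset.Icc 1 m, X t ω = ((m : ℝ) + 1) • x - X (m + 1 : ℕ) ω := by
    have := sum_eq_smul_sampleMean X m.succ_ne_zero ω
    rw [Finset.sum_Icc_succ_top (by lia)] at this
    rw [eq_sub_iff_add_eq, hx, ← Nat.cast_succ, ← this]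
  have hsum' : ∑ t ∈ Finset.Icc 1 m, X ((t : ℤ) + 1) ω = ((m : ℝ) + 1) • x - X 1 ω := by
    have := sum_Icc_sub_one (fun t => X (t + 1) ω) m
    simp only [sub_add_cancel] at this
    rw [hsum, zero_add] at this
    push_cast at this
    rw [eq_sub_iff_add_eq]
    exact (sub_left_injective this).symm
  have hprod : ∑ t ∈ Finset.Icc 1 m, rankOne ℝ (X ((t : ℤ) + 1) ω) (X t ω)
      = Ψ ∘L (∑ t ∈ Finset.Icc 1 m, covDev P X t ω) + (m : ℝ) • (Ψ ∘L covOp P X)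
        + ∑ t ∈ Finset.Icc 1 m, rankOne ℝ (ε (t + 1) ω) (X t ω) := by
    have (t : ℕ) : rankOne ℝ (X ((t : ℤ) + 1) ω) (X t ω)
        = Ψ ∘L covDev P X t ω + Ψ ∘L covOp P X + rankOne ℝ (ε (t + 1) ω) (X t ω) := by
      rw [hω, add_sub_cancel_right, map_add, add_apply, covDev, ContinuousLinearMap.comp_sub,
        comp_rankOne, sub_add_cancel]
    simp_rw [this]
    rw [Finset.sum_add_distrib, Finset.sum_add_distrib, ContinuousLinearMap.comp_finsetSum]
    simp [← Nat.cast_smul_eq_nsmul ℝ]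
  have hwin : ∑ t ∈ Finset.Icc 1 (m + 1), covDev P X t ω - covDev P X (m + 1 : ℕ) ω
      = ∑ t ∈ Finset.Icc 1 m, covDev P X t ω := by
    rw [Finset.sum_Icc_succ_top (by lia), add_sub_cancel_right]
  rw [sampleCrossCovOp, add_tsub_cancel_right, Nat.cast_succ, add_sub_cancel_right, ← hx, hwin]
  conv_lhs => rw [h1]
  rw [← smul_sub, sum_rankOne_sub, hsum, hsum', hprod]
  simp only [map_smul, smul_apply, Nat.card_Icc, add_tsub_cancel_right, map_sub,
    sub_apply]
  congr 1
  module

end Sample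

/-! ### Noise of the covariance recursion -/

section Moments

lemma lintegral_enorm_pow_four_lt_top {Ω E : Type*} [MeasurableSpace Ω] [NormedAddCommGroup E]
    {P : Measure Ω} {f : Ω → E} (hf : MemLp f 4 P) :
    ∫⁻ ω, ‖f ω‖ₑ ^ 4 ∂P < ∞ := by
  have h := lintegral_rpow_enorm_lt_top_of_eLpNorm_lt_top (by norm_num) (by norm_num) hf.2
  simpa using h

lemma lintegral_enorm_sq_lt_top {Ω E : Type*} [MeasurableSpace Ω] [NormedAddCommGroup E]
    {P : Measure Ω} {f : Ω → E} (hf : MemLp f 2 P) :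
    ∫⁻ ω, ‖f ω‖ₑ ^ 2 ∂P < ∞ := by
  have h := lintegral_rpow_enorm_lt_top_of_eLpNorm_lt_top (by norm_num) (by norm_num) hf.2
  simpa using h

variable {Ω H : Type*} [MeasurableSpace Ω] [NormedAddCommGroup H] [InnerProductSpace ℝ H]
  [CompleteSpace H]

/-- The noise in the recursion for `X t ⊗ X t - C₀`, that is
`ε t ⊗ Ψ X (t - 1) + Ψ X (t - 1) ⊗ ε t + (ε t ⊗ ε t - C_ε)`, where the covariance operator
`C_ε` of the innovations is written as `C₀ - Ψ C₀ Ψ*`. -/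
noncomputable def covNoise (P : Measure Ω) (Ψ : H →L[ℝ] H) (ε X : ℤ → Ω → H) (t : ℤ) (ω : Ω) :
    H →L[ℝ] H :=
  rankOne ℝ (ε t ω) (Ψ (X (t - 1) ω)) + rankOne ℝ (Ψ (X (t - 1) ω)) (ε t ω)
    + (rankOne ℝ (ε t ω) (ε t ω)
      - (covOp P X - Ψ ∘L covOp P X ∘L ContinuousLinearMap.adjoint Ψ))

/-- The covariance recursion, a consequence of the autoregressive equation at time `t`. -/
lemma covDev_eq (P : Measure Ω) {Ψ : H →L[ℝ] H} {ε X : ℤ → Ω → H} {ω : Ω} {t : ℤ}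
    (hω : X t ω = Ψ (X (t - 1) ω) + ε t ω) :
    covDev P X t ω = Ψ ∘L covDev P X (t - 1) ω ∘L ContinuousLinearMap.adjoint Ψ
      + covNoise P Ψ ε X t ω := by
  have h : Ψ ∘L rankOne ℝ (X (t - 1) ω) (X (t - 1) ω) ∘L ContinuousLinearMap.adjoint Ψ
      = rankOne ℝ (Ψ (X (t - 1) ω)) (Ψ (X (t - 1) ω)) := by
    rw [rankOne_comp, comp_rankOne, ContinuousLinearMap.adjoint_adjoint]
  rw [covDev, covDev, covNoise, ContinuousLinearMap.sub_comp, ContinuousLinearMap.comp_sub, h, hω]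
  simp only [map_add, add_apply]
  abel

lemma covNoise_apply (P : Measure Ω) (Ψ : H →L[ℝ] H) (ε X : ℤ → Ω → H) (t : ℤ) (ω : Ω) (v : H) :
    covNoise P Ψ ε X t ω v = inner ℝ (Ψ (X (t - 1) ω)) v • ε t ω
      + inner ℝ (ε t ω) v • Ψ (X (t - 1) ω) + (inner ℝ (ε t ω) v • ε t ω
      - (covOp P X - Ψ ∘L covOp P X ∘L ContinuousLinearMap.adjoint Ψ) v) := rfl

namespace IsStationaryFAR

variable [MeasurableSpace H] [BorelSpace H] {P : Measure Ω} {Ψ : H →L[ℝ] H} {ε X : ℤ → Ω → H}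

lemma lintegral_process_pow (h : IsStationaryFAR P Ψ ε X) (t : ℤ) (k : ℕ) :
    ∫⁻ ω, ‖X t ω‖ₑ ^ k ∂P = ∫⁻ ω, ‖X 0 ω‖ₑ ^ k ∂P :=
  ((h.identDistrib_process t).comp (measurable_enorm.pow_const k)).lintegral_eq

lemma lintegral_innov_pow (h : IsStationaryFAR P Ψ ε X) (t : ℤ) (k : ℕ) :
    ∫⁻ ω, ‖ε t ω‖ₑ ^ k ∂P = ∫⁻ ω, ‖ε 0 ω‖ₑ ^ k ∂P :=
  ((h.identDistrib t).comp (measurable_enorm.pow_const k)).lintegral_eq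

variable [IsProbabilityMeasure P]

lemma memLp_covNoise (h : IsStationaryFAR P Ψ ε X) (hX : MemLp (X 0) 4 P) (t : ℤ) (v : H) :
    MemLp (fun ω => covNoise P Ψ ε X t ω v) 2 P := by
  have hΨX : MemLp (fun ω => Ψ (X (t - 1) ω)) 4 P := Ψ.comp_memLp' (h.memLp_process hX (t - 1))
  have hε := h.memLp t
  simp only [covNoise_apply]
  exact ((hΨX.inner_smul hε v).add (hε.inner_smul hΨX v)).add
    ((hε.inner_smul hε v).sub (memLp_const _))

variable [SecondCountableTopology H]

lemma aestronglyMeasurable_covNoise (h : IsStationaryFAR P Ψ ε X) (hX : MemLp (X 0) 4 P) (t : ℤ)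
    (v : H) : AEStronglyMeasurable[pastSigma ε t] (fun ω => covNoise P Ψ ε X t ω v) P := by
  have hXm : AEStronglyMeasurable[pastSigma ε t] (X (t - 1)) P :=
    (h.aestronglyMeasurable_pastSigma hX (t - 1)).mono (pastSigma_mono ε (by lia))
  have hεm : AEStronglyMeasurable[pastSigma ε t] (ε t) P :=
    (measurable_pastSigma ε le_rfl).stronglyMeasurable.aestronglyMeasurable
  have hc : Continuous fun p : H × H => inner ℝ (Ψ p.1) v • p.2 + inner ℝ p.2 v • Ψ p.1
      + (inner ℝ p.2 v • p.2
        - (covOp P X - Ψ ∘L covOp P X ∘L ContinuousLinearMap.adjoint Ψ) v) := by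
    fun_prop
  exact hc.comp_aestronglyMeasurable (hXm.prodMk hεm)

/-- For fixed values `w` of the noise at time `s` and `x` of `X (t - 1)`, the inner product of `w`
with the noise at time `t` has mean zero: its linear part in `ε t` because `ε t` is centred, its
quadratic part by `covOp_sub_apply`. -/
lemma integral_inner_covNoise_of_lt (h : IsStationaryFAR P Ψ ε X) (hX : MemLp (X 0) 4 P)
    {s t : ℤ} (hst : s < t) (v : H) :
    ∫ ω, inner ℝ (covNoise P Ψ ε X s ω v) (covNoise P Ψ ε X t ω v) ∂P = 0 := by
  set c := (covOp P X - Ψ ∘L covOp P X ∘L ContinuousLinearMap.adjoint Ψ) v with hc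
  have hUm : AEStronglyMeasurable[pastSigma ε (t - 1)]
      (fun ω => (covNoise P Ψ ε X s ω v, X (t - 1) ω)) P :=
    ((h.aestronglyMeasurable_covNoise hX s v).mono (pastSigma_mono ε (by lia))).prodMk
      (h.aestronglyMeasurable_pastSigma hX (t - 1))
  refine h.integral_innov_eq_zero (sub_one_lt t) hUm
    (φ := fun p : (H × H) × H => inner ℝ p.1.1 (inner ℝ (Ψ p.1.2) v • p.2
      + inner ℝ p.2 v • Ψ p.1.2 + (inner ℝ p.2 v • p.2 - c))) (by fun_prop)
    ((h.memLp_covNoise hX s v).integrable_inner (h.memLp_covNoise hX t v)) fun ⟨w, x⟩ => ?_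
  have hε2 := h.memLp_two_innov t
  have hi1 : Integrable (fun ω => inner ℝ (Ψ x) v • ε t ω) P :=
    (hε2.integrable (by norm_num)).smul _
  have hi2 : Integrable (fun ω => inner ℝ (ε t ω) v • Ψ x) P :=
    ((hε2.inner_const v).integrable (by norm_num)).smul_const _
  have hi3 := (hε2.inner_smul hε2 v (r := 1)).integrable le_rfl
  have hi4 : Integrable (fun ω => inner ℝ (ε t ω) v • ε t ω - c) P :=
    hi3.sub (integrable_const c)
  change ∫ ω, inner ℝ w (inner ℝ (Ψ x) v • ε t ω
      + inner ℝ (ε t ω) v • Ψ x + (inner ℝ (ε t ω) v • ε t ω - c)) ∂P = 0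
  rw [integral_inner (by exact (hi1.add hi2).add hi4), integral_add (by exact hi1.add hi2) hi4,
    integral_add hi1 hi2, integral_smul, h.mean_zero, integral_smul_const,
    h.integral_inner_innov, integral_sub hi3 (integrable_const c), ← h.covOp_sub_apply hX t]
  simp [hc]

lemma integral_inner_covNoise (h : IsStationaryFAR P Ψ ε X) (hX : MemLp (X 0) 4 P)
    {s t : ℤ} (hst : s ≠ t) (v : H) :
    ∫ ω, inner ℝ (covNoise P Ψ ε X s ω v) (covNoise P Ψ ε X t ω v) ∂P = 0 := by
  rcases hst.lt_or_gt with hlt | hlt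
  · exact h.integral_inner_covNoise_of_lt hX hlt v
  · simp_rw [real_inner_comm (covNoise P Ψ ε X t _ v)]
    exact h.integral_inner_covNoise_of_lt hX hlt v

lemma integral_inner_innov_innov (h : IsStationaryFAR P Ψ ε X) {s t : ℤ} (hst : s ≠ t) :
    ∫ ω, inner ℝ (ε s ω) (ε t ω) ∂P = 0 := by
  have hlt {s t : ℤ} (hst : s < t) : ∫ ω, inner ℝ (ε s ω) (ε t ω) ∂P = 0 := by
    refine h.integral_innov_eq_zero hst
      (measurable_pastSigma ε le_rfl).stronglyMeasurable.aestronglyMeasurable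
      (φ := fun p : H × H => inner ℝ p.1 p.2) (by fun_prop)
      ((h.memLp_two_innov s).integrable_inner (h.memLp_two_innov t)) fun u => ?_
    rw [integral_inner ((h.memLp_two_innov t).integrable (by norm_num)), h.mean_zero,
      inner_zero_right]
  rcases hst.lt_or_gt with h1 | h1
  · exact hlt h1
  · simp_rw [real_inner_comm (ε t _)]
    exact hlt h1

/-- The operators `ε (t + 1) ⊗ X t` are orthogonal in mean. -/
lemma integral_inner_crossNoise (h : IsStationaryFAR P Ψ ε X) (hX : MemLp (X 0) 4 P) {s t : ℤ}
    (hst : s ≠ t) (v : H) :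
    ∫ ω, inner ℝ (rankOne ℝ (ε (s + 1) ω) (X s ω) v) (rankOne ℝ (ε (t + 1) ω) (X t ω) v) ∂P
      = 0 := by
  have hL (t : ℤ) : MemLp (fun ω => rankOne ℝ (ε (t + 1) ω) (X t ω) v) 2 P :=
    (h.memLp_process hX t).inner_smul (h.memLp (t + 1)) v
  have hlt {s t : ℤ} (hst : s < t) : ∫ ω, inner ℝ (rankOne ℝ (ε (s + 1) ω) (X s ω) v)
      (rankOne ℝ (ε (t + 1) ω) (X t ω) v) ∂P = 0 := by
    have hXs : AEStronglyMeasurable[pastSigma ε t] (X s) P :=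
      (h.aestronglyMeasurable_pastSigma hX s).mono (pastSigma_mono ε hst.le)
    have hεs : AEStronglyMeasurable[pastSigma ε t] (ε (s + 1)) P :=
      (measurable_pastSigma ε (by lia)).stronglyMeasurable.aestronglyMeasurable
    refine h.integral_innov_eq_zero (lt_add_one t)
      ((hXs.prodMk hεs).prodMk (h.aestronglyMeasurable_pastSigma hX t))
      (φ := fun p : ((H × H) × H) × H => inner ℝ (inner ℝ p.1.1.1 v • p.1.1.2)
        (inner ℝ p.1.2 v • p.2)) (by fun_prop) ((hL s).integrable_inner (hL t)) fun u => ?_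
    change ∫ ω, inner ℝ (inner ℝ u.1.1 v • u.1.2) (inner ℝ u.2 v • ε (t + 1) ω) ∂P = 0
    have hi : Integrable (fun ω => inner ℝ u.2 v • ε (t + 1) ω) P :=
      ((h.memLp_two_innov _).integrable (by norm_num)).smul _
    rw [integral_inner hi, integral_smul,
      h.mean_zero, smul_zero, inner_zero_right]
  rcases hst.lt_or_gt with h1 | h1
  · exact hlt h1
  · simp_rw [real_inner_comm (rankOne ℝ (ε (t + 1) _) (X t _) v)]
    exact hlt h1

end IsStationaryFAR

end Moments

/-! ### Root-`n` bounds -/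

section RootN

lemma one_le_natCast_rpow {n : ℕ} (hn : n ≠ 0) : (1 : ℝ≥0∞) ≤ (n : ℝ≥0∞) ^ (1 / 2 : ℝ) :=
  ENNReal.one_le_rpow (by exact_mod_cast Nat.one_le_iff_ne_zero.2 hn) (by norm_num)

variable {Ω H : Type*} [MeasurableSpace Ω] [NormedAddCommGroup H] [InnerProductSpace ℝ H]
  [CompleteSpace H]

lemma hsNorm_covDev_le (P : Measure Ω) (X : ℤ → Ω → H) (t : ℤ) (ω : Ω) :
    hsNorm (covDev P X t ω) ≤ ‖X t ω‖ₑ ^ 2 + hsNorm (covOp P X) := by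
  refine (hsNorm_sub_le _ _).trans ?_
  rw [hsNorm_rankOne, sq]

lemma hsNorm_covNoise_le {P : Measure Ω} {Ψ : H →L[ℝ] H} {ε X : ℤ → Ω → H}
    (hΨ : ‖Ψ‖ₑ < 1) (t : ℤ) (ω : Ω) :
    hsNorm (covNoise P Ψ ε X t ω) ≤ 3 * (‖ε t ω‖ₑ ^ 2 + ‖X (t - 1) ω‖ₑ ^ 2)
      + 2 * hsNorm (covOp P X) := by
  set a := ‖ε t ω‖ₑ
  set b := ‖X (t - 1) ω‖ₑ
  have hb : ‖Ψ (X (t - 1) ω)‖ₑ ≤ b :=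
    (Ψ.le_opENorm _).trans (mul_le_of_le_one_left zero_le hΨ.le)
  have hc : hsNorm (Ψ ∘L covOp P X ∘L ContinuousLinearMap.adjoint Ψ) ≤ hsNorm (covOp P X) := by
    refine (hsNorm_comp_comp_le _ _ _).trans (mul_le_of_le_one_left zero_le ?_)
    rw [enorm_adjoint]
    exact mul_le_one₀ hΨ.le zero_le hΨ.le
  have h1 : hsNorm (rankOne ℝ (ε t ω) (Ψ (X (t - 1) ω))) ≤ a ^ 2 + b ^ 2 := by
    rw [hsNorm_rankOne]
    exact (mul_le_mul_right hb _).trans (ENNReal.mul_le_sq_add_sq a b)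
  have h2 : hsNorm (rankOne ℝ (Ψ (X (t - 1) ω)) (ε t ω)) ≤ a ^ 2 + b ^ 2 := by
    rw [hsNorm_rankOne, mul_comm]
    exact (mul_le_mul_right hb _).trans (ENNReal.mul_le_sq_add_sq a b)
  have h3 : hsNorm (rankOne ℝ (ε t ω) (ε t ω)) ≤ a ^ 2 + b ^ 2 := by
    rw [hsNorm_rankOne, ← sq]
    exact le_self_add
  calc hsNorm (covNoise P Ψ ε X t ω)
      ≤ ((a ^ 2 + b ^ 2) + (a ^ 2 + b ^ 2))
        + ((a ^ 2 + b ^ 2) + (hsNorm (covOp P X) + hsNorm (covOp P X))) :=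
        (hsNorm_add_le _ _).trans (add_le_add ((hsNorm_add_le _ _).trans (add_le_add h1 h2))
          ((hsNorm_sub_le _ _).trans (add_le_add h3 ((hsNorm_sub_le _ _).trans
            (add_le_add le_rfl hc)))))
    _ = _ := by ring

/-- A sum of `n` random operators that are orthogonal in mean and have second moments at most `K`
is of order `√(K n)` in mean. -/
lemma lintegral_hsNorm_sum_le [SecondCountableTopology H] {P : Measure Ω}
    [IsProbabilityMeasure P] {N : ℕ → Ω → H →L[ℝ] H}
    (hN : ∀ i v, MemLp (fun ω => N i ω v) 2 P)
    (hort : ∀ i j v, i ≠ j → ∫ ω, inner ℝ (N i ω v) (N j ω v) ∂P = 0) {K : ℝ≥0∞}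
    (hK : ∀ i, ∫⁻ ω, hsNorm (N i ω) ^ 2 ∂P ≤ K) (n : ℕ) :
    ∫⁻ ω, hsNorm (∑ t ∈ Finset.Icc 1 n, N t ω) ∂P ≤ K ^ (1 / 2 : ℝ) * (n : ℝ≥0∞) ^ (1 / 2 : ℝ) := by
  have hm : AEMeasurable (fun ω => hsNorm (∑ t ∈ Finset.Icc 1 n, N t ω)) P :=
    aemeasurable_hsNorm fun v => by
      simpa only [sum_apply] using (memLp_finsetSum (Finset.Icc 1 n) fun i _ => hN i v).1
  have h : (∫⁻ ω, hsNorm (∑ t ∈ Finset.Icc 1 n, N t ω) ∂P) ^ 2 ≤ K * n := by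
    refine (lintegral_sq_le hm).trans ?_
    rw [lintegral_hsNorm_sum_sq _ hN hort]
    refine (Finset.sum_le_sum fun i _ => hK i).trans_eq ?_
    simp [mul_comm]
  rw [← ENNReal.mul_rpow_of_nonneg _ _ (by norm_num), ← ENNReal.rpow_le_rpow_iff two_pos,
    ← ENNReal.rpow_mul]
  simpa using h

namespace IsStationaryFAR

lemma lintegral_hsNorm_covDev_le [MeasurableSpace H] [BorelSpace H] {P : Measure Ω}
    [IsProbabilityMeasure P] {Ψ : H →L[ℝ] H} {ε X : ℤ → Ω → H} (h : IsStationaryFAR P Ψ ε X)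
    (t : ℤ) :
    ∫⁻ ω, hsNorm (covDev P X t ω) ∂P ≤ ∫⁻ ω, ‖X 0 ω‖ₑ ^ 2 ∂P + hsNorm (covOp P X) := by
  refine (lintegral_mono fun ω => hsNorm_covDev_le P X t ω).trans_eq ?_
  rw [lintegral_add_right _ measurable_const, h.lintegral_process_pow]
  simp

variable [SecondCountableTopology H] [MeasurableSpace H] [BorelSpace H]
  {P : Measure Ω} {Ψ : H →L[ℝ] H} {ε X : ℤ → Ω → H}

lemma aemeasurable_hsNorm_covDev (h : IsStationaryFAR P Ψ ε X) (t : ℤ) :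
    AEMeasurable (fun ω => hsNorm (covDev P X t ω)) P := by
  refine aemeasurable_hsNorm fun v => ?_
  have hc : Continuous fun x : H => inner ℝ x v • x - covOp P X v := by fun_prop
  exact hc.comp_aestronglyMeasurable (h.measurable_process t).aestronglyMeasurable

variable [IsProbabilityMeasure P]

lemma hsNorm_covOp_lt_top (h : IsStationaryFAR P Ψ ε X) (hX : MemLp (X 0) 4 P) :
    hsNorm (covOp P X) < ∞ := by
  have hX2 := h.memLp_two_process hX 0
  have h1 : hsNorm (covOp P X) ^ 2 ≤ ∫⁻ ω, ‖X 0 ω‖ₑ ^ 4 ∂P := by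
    refine (hsNorm_integral_sq_le (integrable_rankOne hX2 hX2)).trans_eq ?_
    refine lintegral_congr fun ω => ?_
    rw [hsNorm_rankOne]
    ring
  exact (ENNReal.pow_lt_top_iff.1 (h1.trans_lt (lintegral_enorm_pow_four_lt_top hX))).resolve_right
    two_ne_zero

/-- The bound is uniform in `t` because `X t` and `ε t` have laws that do not depend on `t`. -/
lemma exists_lintegral_hsNorm_covNoise_le (h : IsStationaryFAR P Ψ ε X) (hX : MemLp (X 0) 4 P) :
    ∃ K : ℝ≥0∞, K ≠ ∞ ∧ ∀ t, ∫⁻ ω, hsNorm (covNoise P Ψ ε X t ω) ^ 2 ∂P ≤ K := by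
  refine ⟨144 * (∫⁻ ω, ‖ε 0 ω‖ₑ ^ 4 ∂P + ∫⁻ ω, ‖X 0 ω‖ₑ ^ 4 ∂P) + 16 * hsNorm (covOp P X) ^ 2,
    ?_, fun t => ?_⟩
  · have h1 := lintegral_enorm_pow_four_lt_top hX
    have h2 := lintegral_enorm_pow_four_lt_top (h.memLp 0)
    have h3 := h.hsNorm_covOp_lt_top hX
    finiteness
  · have hb (ω : Ω) : hsNorm (covNoise P Ψ ε X t ω) ^ 2
        ≤ 144 * (‖ε t ω‖ₑ ^ 4 + ‖X (t - 1) ω‖ₑ ^ 4) + 16 * hsNorm (covOp P X) ^ 2 :=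
      calc hsNorm (covNoise P Ψ ε X t ω) ^ 2
          ≤ (3 * (‖ε t ω‖ₑ ^ 2 + ‖X (t - 1) ω‖ₑ ^ 2) + 2 * hsNorm (covOp P X)) ^ 2 := by
            gcongr
            exact hsNorm_covNoise_le h.enorm_lt_one t ω
        _ ≤ 4 * ((3 * (‖ε t ω‖ₑ ^ 2 + ‖X (t - 1) ω‖ₑ ^ 2)) ^ 2 + (2 * hsNorm (covOp P X)) ^ 2) :=
            ENNReal.add_sq_le _ _
        _ = 36 * (‖ε t ω‖ₑ ^ 2 + ‖X (t - 1) ω‖ₑ ^ 2) ^ 2 + 16 * hsNorm (covOp P X) ^ 2 := by ring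
        _ ≤ 36 * (4 * ((‖ε t ω‖ₑ ^ 2) ^ 2 + (‖X (t - 1) ω‖ₑ ^ 2) ^ 2))
            + 16 * hsNorm (covOp P X) ^ 2 := by
            gcongr
            exact ENNReal.add_sq_le _ _
        _ = _ := by ring
    refine (lintegral_mono hb).trans_eq ?_
    have hm := (h.measurable_innov t).enorm.pow_const 4
    rw [lintegral_add_right _ measurable_const, lintegral_const_mul' _ _ (by norm_num),
      lintegral_add_left hm, h.lintegral_process_pow, h.lintegral_innov_pow]
    simp

/-- The sums of `X t ⊗ X t - C₀` are of order `√n` in mean. -/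
lemma exists_lintegral_hsNorm_sum_covDev_le (h : IsStationaryFAR P Ψ ε X)
    (hX : MemLp (X 0) 4 P) : ∃ K : ℝ≥0∞, K ≠ ∞ ∧ ∀ n : ℕ, n ≠ 0 →
      ∫⁻ ω, hsNorm (∑ t ∈ Finset.Icc 1 n, covDev P X t ω) ∂P ≤ K * (n : ℝ≥0∞) ^ (1 / 2 : ℝ) := by
  obtain ⟨K, hK, hKt⟩ := h.exists_lintegral_hsNorm_covNoise_le hX
  set A := ContinuousLinearMap.adjoint Ψ with hA
  set m := ∫⁻ ω, ‖X 0 ω‖ₑ ^ 2 ∂P + hsNorm (covOp P X) with hm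
  have hC := h.hsNorm_covOp_lt_top hX
  have hmt : m ≠ ∞ :=
    (ENNReal.add_lt_top.2 ⟨lintegral_enorm_sq_lt_top (h.memLp_two_process hX 0), hC⟩).ne
  have hΨ : ‖Ψ‖ₑ * ‖A‖ₑ < 1 := by
    rw [hA, enorm_adjoint]
    exact mul_lt_one_of_nonneg_of_lt_one_left zero_le h.enorm_lt_one h.enorm_lt_one.le
  have hinv : (1 - ‖Ψ‖ₑ * ‖A‖ₑ)⁻¹ ≠ ∞ := ENNReal.inv_ne_top.2 (tsub_pos_of_lt hΨ).ne'
  refine ⟨(1 - ‖Ψ‖ₑ * ‖A‖ₑ)⁻¹ * (m + m + K ^ (1 / 2 : ℝ)), ?_, fun n hn => ?_⟩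
  · finiteness
  · have hae : ∀ᵐ ω ∂P, hsNorm (∑ t ∈ Finset.Icc 1 n, covDev P X t ω) ≤ (1 - ‖Ψ‖ₑ * ‖A‖ₑ)⁻¹ *
        (hsNorm (covDev P X 0 ω) + hsNorm (covDev P X n ω)
          + hsNorm (∑ t ∈ Finset.Icc 1 n, covNoise P Ψ ε X t ω)) := by
      filter_upwards [ae_all_iff.2 h.far] with ω hω
      refine hsNorm_sum_le_of_recursion hΨ (T := fun t => covDev P X t ω)
        (N := fun t => covNoise P Ψ ε X t ω) (fun t => ?_) (fun t => covDev_eq P (hω t)) n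
      exact ((hsNorm_covDev_le P X t ω).trans_lt (by finiteness)).ne
    have hmeas := h.aemeasurable_hsNorm_covDev
    refine (lintegral_mono_ae hae).trans ?_
    rw [lintegral_const_mul' _ _ hinv, mul_assoc,
      lintegral_add_left' (by exact (hmeas 0).add (hmeas n)), lintegral_add_left' (hmeas 0)]
    gcongr
    rw [add_mul, add_mul]
    have h1 := one_le_natCast_rpow hn
    gcongr
    · exact (h.lintegral_hsNorm_covDev_le 0).trans (le_mul_of_one_le_right zero_le h1)
    · exact (h.lintegral_hsNorm_covDev_le n).trans (le_mul_of_one_le_right zero_le h1)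
    · exact lintegral_hsNorm_sum_le (N := fun t : ℕ => covNoise P Ψ ε X t)
        (fun t v => h.memLp_covNoise hX t v)
        (fun s t v hst => h.integral_inner_covNoise hX (by exact_mod_cast hst) v)
        (fun t => hKt t) n

/-- The sums of `ε (t + 1) ⊗ X t` are of order `√n` in mean. -/
lemma exists_lintegral_hsNorm_sum_crossNoise_le (h : IsStationaryFAR P Ψ ε X)
    (hX : MemLp (X 0) 4 P) : ∃ K : ℝ≥0∞, K ≠ ∞ ∧ ∀ n : ℕ,
      ∫⁻ ω, hsNorm (∑ t ∈ Finset.Icc 1 n, rankOne ℝ (ε (t + 1) ω) (X t ω)) ∂P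
        ≤ K * (n : ℝ≥0∞) ^ (1 / 2 : ℝ) := by
  set K := ∫⁻ ω, ‖ε 0 ω‖ₑ ^ 4 ∂P + ∫⁻ ω, ‖X 0 ω‖ₑ ^ 4 ∂P with hK
  have h1 := lintegral_enorm_pow_four_lt_top hX
  have h2 := lintegral_enorm_pow_four_lt_top (h.memLp 0)
  refine ⟨K ^ (1 / 2 : ℝ), by finiteness, fun n => ?_⟩
  refine lintegral_hsNorm_sum_le (N := fun (t : ℕ) ω => rankOne ℝ (ε (t + 1) ω) (X t ω))
    (fun t v => (h.memLp_process hX t).inner_smul (h.memLp (t + 1)) v)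
    (fun s t v hst => h.integral_inner_crossNoise hX (by exact_mod_cast hst) v) (fun t => ?_) n
  have hm := (h.measurable_innov (t + 1)).enorm.pow_const 4
  rw [hK, ← h.lintegral_innov_pow (t + 1), ← h.lintegral_process_pow t, ← lintegral_add_left hm]
  refine lintegral_mono fun ω => ?_
  rw [hsNorm_rankOne, mul_pow]
  refine (ENNReal.mul_le_sq_add_sq _ _).trans_eq ?_
  ring

/-- The sums of the observations are of order `√n` in mean square. -/
lemma exists_lintegral_enorm_sum_process_le (h : IsStationaryFAR P Ψ ε X)
    (hX : MemLp (X 0) 4 P) : ∃ K : ℝ≥0∞, K ≠ ∞ ∧ ∀ n : ℕ, n ≠ 0 →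
      ∫⁻ ω, ‖∑ t ∈ Finset.Icc 1 n, X t ω‖ₑ ^ 2 ∂P ≤ K * n := by
  set m := ∫⁻ ω, ‖X 0 ω‖ₑ ^ 2 ∂P with hm
  set e := ∫⁻ ω, ‖ε 0 ω‖ₑ ^ 2 ∂P with he
  have hmt : m < ∞ := lintegral_enorm_sq_lt_top (h.memLp_two_process hX 0)
  have het : e < ∞ := lintegral_enorm_sq_lt_top (h.memLp_two_innov 0)
  set c := (1 - ‖Ψ‖ₑ)⁻¹ with hcd
  have hc : c ≠ ∞ := ENNReal.inv_ne_top.2 (tsub_pos_of_lt h.enorm_lt_one).ne'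
  refine ⟨c ^ 2 * (4 * (4 * (m + m) + e)), by finiteness, fun n hn => ?_⟩
  have hae : ∀ᵐ ω ∂P, ‖∑ t ∈ Finset.Icc 1 n, X t ω‖ₑ ^ 2 ≤ c ^ 2 *
      (4 * (4 * (‖X 0 ω‖ₑ ^ 2 + ‖X n ω‖ₑ ^ 2) + ‖∑ t ∈ Finset.Icc 1 n, ε t ω‖ₑ ^ 2)) := by
    filter_upwards [ae_all_iff.2 h.far] with ω hω
    have h1 := enorm_sum_le_of_recursion h.enorm_lt_one (x := fun t => X t ω)
      (e := fun t => ε t ω) hω n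
    refine (pow_le_pow_left₀ zero_le h1 2).trans ?_
    rw [mul_pow]
    gcongr
    refine (ENNReal.add_sq_le _ _).trans ?_
    gcongr
    exact ENNReal.add_sq_le _ _
  have hXm (t : ℤ) : Measurable fun ω => ‖X t ω‖ₑ ^ 2 := (h.measurable_process t).enorm.pow_const 2
  have h1 : (1 : ℝ≥0∞) ≤ n := by exact_mod_cast Nat.one_le_iff_ne_zero.2 hn
  refine (lintegral_mono_ae hae).trans ?_
  rw [lintegral_const_mul' _ _ (by finiteness), lintegral_const_mul' _ _ (by norm_num),
    lintegral_add_left (by exact ((hXm 0).add (hXm n)).const_mul 4),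
    lintegral_const_mul' _ _ (by norm_num),
    lintegral_add_left (hXm 0), h.lintegral_process_pow n,
    lintegral_enorm_sum_sq (D := fun t : ℕ => ε t) _ (fun t => h.memLp_two_innov t)
      fun s t hst => h.integral_inner_innov_innov (by exact_mod_cast hst)]
  simp_rw [h.lintegral_innov_pow]
  rw [Finset.sum_const, Nat.card_Icc, add_tsub_cancel_right, nsmul_eq_mul]
  have h2 : 4 * (m + m) ≤ 4 * (m + m) * n := le_mul_of_one_le_right zero_le h1
  calc _ ≤ c ^ 2 * (4 * (4 * (m + m) * n + n * e)) :=
        mul_le_mul_right (mul_le_mul_right (add_le_add h2 le_rfl) _) _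
    _ = _ := by ring

end IsStationaryFAR

end RootN

/-! ### The stochastic error of the estimator -/

section Estimator

variable {Ω H : Type*} [MeasurableSpace Ω] [NormedAddCommGroup H] [InnerProductSpace ℝ H]
  [CompleteSpace H]

/-- A random variable of order `√n` that, for the sample size `n = m + 1`, dominates
`n ‖Ĉ₀ - C₀‖` and `(n - 1) ‖Ĉ₁ - Ψ C₀‖` in Hilbert–Schmidt norm. The sample mean enters the lag-one
operator with total weight `n + 1` and in two products with `X 1` and `X n`, hence the factor
`4`. -/
noncomputable def errorBound (P : Measure Ω) (ε X : ℤ → Ω → H) (m : ℕ) (ω : Ω) : ℝ≥0∞ :=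
  hsNorm (∑ t ∈ Finset.Icc 1 (m + 1), covDev P X t ω) + hsNorm (covDev P X (m + 1 : ℕ) ω)
    + hsNorm (∑ t ∈ Finset.Icc 1 m, rankOne ℝ (ε (t + 1) ω) (X t ω))
    + 4 * ((m + 1 : ℕ) * ‖sampleMean X (m + 1) ω‖ₑ ^ 2)
    + ‖X 1 ω‖ₑ ^ 2 + ‖X (m + 1 : ℕ) ω‖ₑ ^ 2

lemma hsNorm_sampleCovOp_sub_le (P : Measure Ω) (ε X : ℤ → Ω → H) (m : ℕ) (ω : Ω) :
    hsNorm (sampleCovOp X (m + 1) ω - covOp P X)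
      ≤ ((m + 1 : ℕ) : ℝ≥0∞)⁻¹ * errorBound P ε X m ω := by
  rw [sampleCovOp_sub P X m.succ_ne_zero, hsNorm_smul, enorm_inv (by positivity),
    Real.enorm_natCast]
  gcongr
  refine (hsNorm_sub_le _ _).trans ?_
  rw [hsNorm_smul, Real.enorm_natCast, hsNorm_rankOne, ← sq]
  set g : ℝ≥0∞ := (m + 1 : ℕ) * ‖sampleMean X (m + 1) ω‖ₑ ^ 2 with hg
  calc _ ≤ hsNorm (∑ t ∈ Finset.Icc 1 (m + 1), covDev P X t ω) + g
        + (hsNorm (covDev P X (m + 1 : ℕ) ω)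
          + hsNorm (∑ t ∈ Finset.Icc 1 m, rankOne ℝ (ε (t + 1) ω) (X t ω)) + 3 * g
          + ‖X 1 ω‖ₑ ^ 2 + ‖X (m + 1 : ℕ) ω‖ₑ ^ 2) := le_self_add
    _ = errorBound P ε X m ω := by
      rw [errorBound, ← hg]
      ring

lemma hsNorm_sampleCrossCovOp_sub_le (P : Measure Ω) {Ψ : H →L[ℝ] H} {ε X : ℤ → Ω → H}
    (hΨ : ‖Ψ‖ₑ ≤ 1) {ω : Ω} (hω : ∀ t, X t ω = Ψ (X (t - 1) ω) + ε t ω) {m : ℕ} (hm : m ≠ 0) :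
    hsNorm (sampleCrossCovOp X (m + 1) ω - Ψ ∘L covOp P X)
      ≤ (m : ℝ≥0∞)⁻¹ * errorBound P ε X m ω := by
  rw [sampleCrossCovOp_sub P hω hm, hsNorm_smul, enorm_inv (by exact_mod_cast hm),
    Real.enorm_natCast]
  gcongr
  set x := sampleMean X (m + 1) ω
  have h1 (T : H →L[ℝ] H) : hsNorm (Ψ ∘L T) ≤ hsNorm T :=
    (hsNorm_comp_le _ _).trans (mul_le_of_le_one_left zero_le hΨ)
  have hx : ‖x‖ₑ ^ 2 ≤ (m + 1 : ℕ) * ‖x‖ₑ ^ 2 :=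
    le_mul_of_one_le_left zero_le (by exact_mod_cast Nat.le_add_left 1 m)
  have h2 (y : H) : hsNorm (rankOne ℝ x y) ≤ ‖x‖ₑ ^ 2 + ‖y‖ₑ ^ 2 := by
    rw [hsNorm_rankOne]
    exact ENNReal.mul_le_sq_add_sq _ _
  have h3 (y : H) : hsNorm (rankOne ℝ y x) ≤ ‖x‖ₑ ^ 2 + ‖y‖ₑ ^ 2 := by
    rw [hsNorm_rankOne, mul_comm]
    exact ENNReal.mul_le_sq_add_sq _ _
  have h4 : hsNorm (((m : ℝ) + 2) • rankOne ℝ x x) = (m + 1 : ℕ) * ‖x‖ₑ ^ 2 + ‖x‖ₑ ^ 2 := by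
    have h5 : (m : ℝ) + 2 = (m + 2 : ℕ) := by push_cast; ring
    rw [hsNorm_smul, h5, Real.enorm_natCast, hsNorm_rankOne]
    push_cast
    ring
  refine (hsNorm_sub_le _ _).trans ((add_le_add ((hsNorm_add_le _ _).trans (add_le_add
    ((hsNorm_add_le _ _).trans (add_le_add ((hsNorm_add_le _ _).trans (add_le_add
    ((h1 _).trans (hsNorm_sub_le _ _)) le_rfl)) (h2 _))) (h3 _))) h4.le).trans ?_)
  calc _ = hsNorm (∑ t ∈ Finset.Icc 1 (m + 1), covDev P X t ω)
        + hsNorm (covDev P X (m + 1 : ℕ) ω)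
        + hsNorm (∑ t ∈ Finset.Icc 1 m, rankOne ℝ (ε (t + 1) ω) (X t ω))
        + ((m + 1 : ℕ) * ‖x‖ₑ ^ 2 + ‖x‖ₑ ^ 2 + ‖x‖ₑ ^ 2 + ‖x‖ₑ ^ 2)
        + ‖X 1 ω‖ₑ ^ 2 + ‖X (m + 1 : ℕ) ω‖ₑ ^ 2 := by ring
    _ ≤ hsNorm (∑ t ∈ Finset.Icc 1 (m + 1), covDev P X t ω)
        + hsNorm (covDev P X (m + 1 : ℕ) ω)
        + hsNorm (∑ t ∈ Finset.Icc 1 m, rankOne ℝ (ε (t + 1) ω) (X t ω))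
        + ((m + 1 : ℕ) * ‖x‖ₑ ^ 2 + (m + 1 : ℕ) * ‖x‖ₑ ^ 2 + (m + 1 : ℕ) * ‖x‖ₑ ^ 2
          + (m + 1 : ℕ) * ‖x‖ₑ ^ 2)
        + ‖X 1 ω‖ₑ ^ 2 + ‖X (m + 1 : ℕ) ω‖ₑ ^ 2 := by gcongr
    _ = errorBound P ε X m ω := by
      rw [errorBound]
      ring

namespace IsStationaryFAR

variable [SecondCountableTopology H] [MeasurableSpace H] [BorelSpace H] {P : Measure Ω}
  {Ψ : H →L[ℝ] H} {ε X : ℤ → Ω → H}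

lemma measurable_sampleMean (h : IsStationaryFAR P Ψ ε X) (n : ℕ) :
    Measurable (sampleMean X n) :=
  (Finset.measurable_fun_sum _ fun (t : ℕ) _ => h.measurable_process t).const_smul _

lemma aemeasurable_hsNorm_sum_covDev (h : IsStationaryFAR P Ψ ε X) (n : ℕ) :
    AEMeasurable (fun ω => hsNorm (∑ t ∈ Finset.Icc 1 n, covDev P X t ω)) P := by
  refine aemeasurable_hsNorm fun v => ?_
  simp only [sum_apply]
  refine Finset.aestronglyMeasurable_fun_sum _ fun t _ => ?_
  have hc : Continuous fun x : H => inner ℝ x v • x - covOp P X v := by fun_prop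
  exact hc.comp_aestronglyMeasurable (h.measurable_process t).aestronglyMeasurable

lemma aemeasurable_hsNorm_sum_crossNoise (h : IsStationaryFAR P Ψ ε X) (n : ℕ) :
    AEMeasurable
      (fun ω => hsNorm (∑ t ∈ Finset.Icc 1 n, rankOne ℝ (ε (t + 1) ω) (X t ω))) P := by
  refine aemeasurable_hsNorm fun v => ?_
  simp only [sum_apply]
  refine Finset.aestronglyMeasurable_fun_sum _ fun t _ => ?_
  have hc : Continuous fun p : H × H => inner ℝ p.1 v • p.2 := by fun_prop
  exact hc.comp_aestronglyMeasurable ((h.measurable_process t).aestronglyMeasurable.prodMk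
    (h.measurable_innov (t + 1)).aestronglyMeasurable)

lemma aemeasurable_errorBound (h : IsStationaryFAR P Ψ ε X) (m : ℕ) :
    AEMeasurable (errorBound P ε X m) P := by
  have h1 := h.aemeasurable_hsNorm_sum_covDev (m + 1)
  have h2 := h.aemeasurable_hsNorm_covDev (m + 1 : ℕ)
  have h3 := h.aemeasurable_hsNorm_sum_crossNoise m
  have h4 := (h.measurable_sampleMean (m + 1)).enorm.aemeasurable (μ := P)
  have h5 (t : ℤ) := (h.measurable_process t).enorm.aemeasurable (μ := P)
  exact ((((h1.add h2).add h3).add (((h4.pow_const 2).const_mul _).const_mul 4)).add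
    ((h5 1).pow_const 2)).add ((h5 (m + 1 : ℕ)).pow_const 2)

variable [IsProbabilityMeasure P]

/-- The fourth moment of the sample mean is not needed: it enters the bound only through
`n ‖X̄‖²`, whose mean is bounded. -/
lemma exists_lintegral_errorBound_le (h : IsStationaryFAR P Ψ ε X) (hX : MemLp (X 0) 4 P) :
    ∃ K : ℝ≥0∞, K ≠ ∞ ∧ ∀ m : ℕ,
      ∫⁻ ω, errorBound P ε X m ω ∂P ≤ K * ((m + 1 : ℕ) : ℝ≥0∞) ^ (1 / 2 : ℝ) := by
  obtain ⟨K₁, hK₁, h1⟩ := h.exists_lintegral_hsNorm_sum_covDev_le hX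
  obtain ⟨K₂, hK₂, h2⟩ := h.exists_lintegral_hsNorm_sum_crossNoise_le hX
  obtain ⟨K₃, hK₃, h3⟩ := h.exists_lintegral_enorm_sum_process_le hX
  set v := ∫⁻ ω, ‖X 0 ω‖ₑ ^ 2 ∂P with hv
  have hvt : v < ∞ := lintegral_enorm_sq_lt_top (h.memLp_two_process hX 0)
  have hC := h.hsNorm_covOp_lt_top hX
  refine ⟨K₁ + (v + hsNorm (covOp P X)) + K₂ + 4 * K₃ + v + v, by finiteness, fun m => ?_⟩
  have hmean : ∫⁻ ω, (m + 1 : ℕ) * ‖sampleMean X (m + 1) ω‖ₑ ^ 2 ∂P ≤ K₃ := by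
    have hm0 : ((m + 1 : ℕ) : ℝ≥0∞) ≠ 0 := by simp
    have hmt : ((m + 1 : ℕ) : ℝ≥0∞) ≠ ∞ := by finiteness
    have e (ω : Ω) : (m + 1 : ℕ) * ‖sampleMean X (m + 1) ω‖ₑ ^ 2
        = ((m + 1 : ℕ) : ℝ≥0∞)⁻¹ * ‖∑ t ∈ Finset.Icc 1 (m + 1), X t ω‖ₑ ^ 2 := by
      rw [sum_eq_smul_sampleMean X m.succ_ne_zero, enorm_smul, Real.enorm_natCast, mul_pow,
        ← mul_assoc, sq ((m + 1 : ℕ) : ℝ≥0∞), ← mul_assoc, ENNReal.inv_mul_cancel hm0 hmt, one_mul]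
    simp_rw [e]
    rw [lintegral_const_mul' _ _ (ENNReal.inv_ne_top.2 hm0), mul_comm]
    refine (mul_le_mul_left (h3 (m + 1) m.succ_ne_zero) _).trans_eq ?_
    rw [mul_assoc, ENNReal.mul_inv_cancel hm0 hmt, mul_one]
  have h4 := h.aemeasurable_hsNorm_sum_covDev (m + 1)
  have h5 := h.aemeasurable_hsNorm_covDev (m + 1 : ℕ)
  have h6 := h.aemeasurable_hsNorm_sum_crossNoise m
  have h7 := (((h.measurable_sampleMean (m + 1)).enorm.aemeasurable (μ := P)).pow_const 2).const_mul
    ((m + 1 : ℕ) : ℝ≥0∞)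
  have h8 (t : ℤ) := ((h.measurable_process t).enorm.aemeasurable (μ := P)).pow_const 2
  have hr := one_le_natCast_rpow m.succ_ne_zero
  set r := ((m + 1 : ℕ) : ℝ≥0∞) ^ (1 / 2 : ℝ) with hrd
  have hrm : (m : ℝ≥0∞) ^ (1 / 2 : ℝ) ≤ r := by
    refine ENNReal.rpow_le_rpow ?_ (by norm_num)
    exact_mod_cast m.le_succ
  have hone (c : ℝ≥0∞) : c ≤ c * r := le_mul_of_one_le_right zero_le hr
  simp only [errorBound]
  rw [lintegral_add_right' _ (h8 _), lintegral_add_right' _ (h8 _),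
    lintegral_add_right' _ (h7.const_mul 4), lintegral_add_right' _ h6, lintegral_add_right' _ h5,
    lintegral_const_mul' _ _ (by norm_num)]
  simp only [add_mul]
  have b1 := h1 (m + 1) m.succ_ne_zero
  have b2 := (h.lintegral_hsNorm_covDev_le (m + 1 : ℕ)).trans (hone _)
  rw [add_mul] at b2
  have b3 := (h2 m).trans (mul_le_mul_right hrm K₂)
  have b4 := (mul_le_mul_right hmean 4).trans (hone _)
  exact add_le_add (add_le_add (add_le_add (add_le_add (add_le_add b1 b2) b3) b4)
    ((h.lintegral_process_pow 1 2).trans_le (hone v)))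
    ((h.lintegral_process_pow _ 2).trans_le (hone v))

/-- The constant is `3 = 2 + 1`, where `m⁻¹ ≤ 2 (m + 1)⁻¹` accounts for the normalization of the
lag-one sample covariance. -/
lemma hsNorm_estimator_sub_le (h : IsStationaryFAR P Ψ ε X) (hX : MemLp (X 0) 4 P) {ω : Ω}
    (hω : ∀ t, X t ω = Ψ (X (t - 1) ω) + ε t ω) {m : ℕ} (hm : m ≠ 0) {α : ℝ} (hα : 0 < α) :
    hsNorm (tikhonovEstimator X (m + 1) α ω - tikhonovOp P X α)
      ≤ ENNReal.ofReal α⁻¹ * (3 * ((m + 1 : ℕ) : ℝ≥0∞)⁻¹ * errorBound P ε X m ω) := by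
  rw [tikhonovEstimator, tikhonovOp, h.crossCovOp_eq hX]
  refine (hsNorm_comp_resolventInv_sub_le (h.isPositive_covOp hX) (isPositive_sampleCovOp X _ ω)
    h.norm_lt_one.le hα).trans ?_
  gcongr
  have h1 : (m : ℝ≥0∞)⁻¹ ≤ 2 * ((m + 1 : ℕ) : ℝ≥0∞)⁻¹ := by
    have hm0 : (m : ℝ≥0∞) ≠ 0 := by exact_mod_cast hm
    rw [← div_eq_mul_inv, ENNReal.le_div_iff_mul_le (Or.inl (by simp)) (Or.inl (by finiteness))]
    calc (m : ℝ≥0∞)⁻¹ * (m + 1 : ℕ) ≤ (m : ℝ≥0∞)⁻¹ * (m * 2) := by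
          gcongr
          exact_mod_cast (by lia : m + 1 ≤ m * 2)
      _ = 2 := by
          rw [← mul_assoc, ENNReal.inv_mul_cancel hm0 (by finiteness), one_mul]
  calc _ ≤ 2 * ((m + 1 : ℕ) : ℝ≥0∞)⁻¹ * errorBound P ε X m ω
        + ((m + 1 : ℕ) : ℝ≥0∞)⁻¹ * errorBound P ε X m ω :=
        add_le_add ((hsNorm_sampleCrossCovOp_sub_le P h.enorm_lt_one.le hω hm).trans
          (by gcongr)) (hsNorm_sampleCovOp_sub_le P ε X m ω)
    _ = _ := by ring

/-- The stochastic error of the Tikhonov estimator is of order `1 / (√n α)` in probability. -/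
theorem isBigOP_estimator (h : IsStationaryFAR P Ψ ε X) (hX : MemLp (X 0) 4 P)
    {α : ℕ → ℝ} (hα : ∀ n : ℕ, 1 ≤ n → 0 < α n) :
    IsBigOP P (fun n ω => hsNorm (tikhonovEstimator X n (α n) ω - tikhonovOp P X (α n)))
      (fun n => 1 / (√(n : ℝ) * α n)) := by
  obtain ⟨K, hK, hKm⟩ := h.exists_lintegral_errorBound_le hX
  intro δ hδ
  -- Markov's inequality for the error bound at level `(M / 3) √n` gives the probability `3 K / M`,
  -- and `K + 1` in place of `K` makes `M` positive
  set M : ℝ := 3 * (K.toReal + 1) / δ with hM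
  have hMpos : 0 < M := by positivity
  refine ⟨M, hMpos, ?_⟩
  filter_upwards [eventually_ge_atTop 2] with n hn
  obtain ⟨m, rfl⟩ : ∃ m, n = m + 1 := ⟨n - 1, by lia⟩
  have hm : m ≠ 0 := by lia
  have hαn := hα (m + 1) (by lia)
  set a := α (m + 1)
  set s : ℝ := √((m + 1 : ℕ) : ℝ) with hs
  have hspos : 0 < s := Real.sqrt_pos.2 (by positivity)
  have hs2 : s * s = (m + 1 : ℕ) := Real.mul_self_sqrt (by positivity)
  have hinv : ((m + 1 : ℕ) : ℝ≥0∞)⁻¹ = ENNReal.ofReal (s * s)⁻¹ := by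
    rw [ENNReal.ofReal_inv_of_pos (by positivity), hs2, ENNReal.ofReal_natCast]
  have hse : ((m + 1 : ℕ) : ℝ≥0∞) ^ (1 / 2 : ℝ) = ENNReal.ofReal s := by
    rw [hs, Real.sqrt_eq_rpow, ← ENNReal.ofReal_rpow_of_nonneg (by positivity) (by norm_num),
      ENNReal.ofReal_natCast]
  have hsub : {ω | ENNReal.ofReal (M * (1 / (s * a)))
        < hsNorm (tikhonovEstimator X (m + 1) a ω - tikhonovOp P X a)}
      ≤ᵐ[P] {ω | ENNReal.ofReal (M / 3 * s) ≤ errorBound P ε X m ω} := by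
    filter_upwards [ae_all_iff.2 h.far] with ω hω
    intro hlt
    have h1 := hlt.trans_le (h.hsNorm_estimator_sub_le hX hω hm hαn)
    by_contra hcon
    have h2 : errorBound P ε X m ω ≤ ENNReal.ofReal (M / 3 * s) := (not_le.1 hcon).le
    refine absurd h1 (not_lt.2 ?_)
    calc _ ≤ ENNReal.ofReal a⁻¹ * (3 * ((m + 1 : ℕ) : ℝ≥0∞)⁻¹ * ENNReal.ofReal (M / 3 * s)) := by
          gcongr
      _ = ENNReal.ofReal (a⁻¹ * (3 * (s * s)⁻¹ * (M / 3 * s))) := by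
          rw [hinv, ENNReal.ofReal_mul (p := a⁻¹) (by positivity),
            ENNReal.ofReal_mul (p := 3 * (s * s)⁻¹) (by positivity),
            ENNReal.ofReal_mul (p := 3) (by norm_num), ENNReal.ofReal_ofNat]
      _ = _ := by
          congr 1
          field_simp
  refine (measure_mono_ae hsub).trans ?_
  have hpos : ENNReal.ofReal (M / 3 * s) ≠ 0 := by
    simp only [ne_eq, ENNReal.ofReal_eq_zero, not_le]
    positivity
  refine (meas_ge_le_lintegral_div (h.aemeasurable_errorBound m) hpos
    ENNReal.ofReal_ne_top).trans ?_
  refine ENNReal.div_le_of_le_mul ((hKm m).trans ?_)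
  rw [hse, ← ENNReal.ofReal_mul hδ.le, ← ENNReal.ofReal_toReal hK,
    ← ENNReal.ofReal_mul ENNReal.toReal_nonneg]
  refine ENNReal.ofReal_le_ofReal ?_
  have h3 : δ * (M / 3 * s) = (K.toReal + 1) * s := by
    rw [hM]
    field_simp
  rw [h3]
  gcongr
  linarith

end IsStationaryFAR

end Estimator

theorem proposition2 {Ω : Type*} [MeasurableSpace Ω] (P : Measure Ω) [IsProbabilityMeasure P]
    (Ψ : L2I →L[ℝ] L2I) (ε X : ℤ → Ω → L2I)
    (hFAR : IsStationaryFAR P Ψ ε X)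
    (hC₀ : CovarianceAssumption (covOp P X))
    (hsource : SourceCondition Ψ (covOp P X))
    (hdep : IsL4mApproximable P X)
    (α : ℕ → ℝ) (hpos : ∀ n : ℕ, 1 ≤ n → 0 < α n)
    (hα : ∀ n : ℕ, 1 ≤ n → 1 / √(n : ℝ) ≤ α n) :
    IsBigOP P (fun n ω => hsNorm (tikhonovEstimator X n (α n) ω - tikhonovOp P X (α n)))
      (fun n => 1 / (√(n : ℝ) * α n)) := by
  -- needed to find that `L²([0,1])` is second countable
  have : Fact ((2 : ℝ≥0∞) ≠ ∞) := ⟨by norm_num⟩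
  exact hFAR.isBigOP_estimator (hdep.1 0) hpos
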